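/- Let $K$ be a number field of degree $d$ with ring of integers $\mathcal O$. A \emph{number system} is a pair $(q,\mathcal D)$, where $q\in\mathcal O$ has all its conjugates of modulus $>1$ and $\mathcal D\subset\mathcal O$ is a set of representatives of $\mathcal O/(q)$ with $0\in\mathcal D$; put $Q=|N_{K/\mathbb Q}(q)|$. It has the \emph{finiteness property} if every $n\in\mathcal O$ has a (necessarily unique) finite expansion $n=\sum_{j\ge 0} n_jq^j$ with $n_j\in\mathcal D$. It is a \emph{canonical number system} (CNS) with base $q$ if $\mathcal D=\{0,1,\dots,Q-1\}$. Given a number system with the finiteness property, let $\mathcal N_\kappa=\{\sum_{j<\kappa}b_jq^j : b_j\in\mathcal D\}$ for $\kappa\ge 0$, and $r_{\nu,\infty}(n)=\sum_{j\ge\nu}n_jq^{j-\nu}$. A real number $\eta\in(0,1]$ is a \emph{carry constant} of $(q,\mathcal D)$ if, for all integers $0\le\rho\le\nu\le\mu$, $$\#\{m\in\mathcal N_\mu : \exists\, n\in\mathcal N_{\nu-\rho},\ r_{\nu,\infty}(m+n)\ne r_{\nu,\infty}(m)\}\ll Q^{\mu-\eta\rho},$$ where the implied constant may depend on $K$, $q$,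 $\mathcal D$ and $\eta$, but not on $\rho,\nu,\mu$. For a $\mathbb Z$-basis $\omega=(\omega_1,\dots,\omega_d)$ of $\mathcal O$, the \emph{fundamental tile} $\mathcal F\subset\mathbb R^d$ is the closure of the set of coordinate vectors, with respect to $\omega$, of the elements $\sum_{j=1}^r b_jq^{-j}$ $(r\ge 1,\ b_j\in\mathcal D)$ of $K$. \textbf{Proposition.} Let $q_0\in\mathcal O$ be the base of a CNS. There is a real number $C$, depending only on $K$ and $q_0$, such that the following holds for every integer $m\ge 2$ for which $q_m:=-m+q_0$ is the base of a CNS with the finiteness property. 1. The CNS with base $q_m$ has a carry constant $\eta_{2,m}\in(0,1]$ with $$\eta_{2,m}\ \ge\ \frac1d-\frac{C}{\log m}.$$ 2. For every $\mathbb Z$-basis of $\mathcal O$, the boundary $\partial\mathcal F_m$ in $\mathbb R^d$ of the fundamental tile associated with $q_m$ has upper box dimension $$\overline{\dim}_B(\partial\mathcal F_m)\ \le\ d-1+\frac{C}{\log m}.$$ -/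

import Mathlib

open scoped NumberField Topology NNReal ENNReal

noncomputable section

namespace NumerationSystem

variable {K : Type*} [Field K] [NumberField K]

/-- The absolute norm `Q = |N(q)|` of an algebraic integer `q`. -/
def absNorm (q : 𝓞 K) : ℕ := (Algebra.norm ℤ q).natAbs

/-- `(q, D)` is a number system: all conjugates of `q` have modulus `> 1`, and `D` is a set of
representatives of `𝓞 K / (q)` which contains `0`. -/
structure IsNumberSystem (q : 𝓞 K) (D : Finset (𝓞 K)) : Prop where
  one_lt_norm_conj : ∀ φ : K →+* ℂ, 1 < ‖φ (q : K)‖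
  zero_mem : (0 : 𝓞 K) ∈ D
  existsUnique_digit : ∀ n : 𝓞 K, ∃! b : 𝓞 K, b ∈ D ∧ q ∣ n - b

/-- The finitely supported sequence `b` is a base-`q` expansion of `n` with digits in `D`:
`n = ∑ b_j q ^ j`. (All but finitely many digits are `0`.) -/
def IsExpansion (q : 𝓞 K) (D : Finset (𝓞 K)) (n : 𝓞 K) (b : ℕ →₀ 𝓞 K) : Prop :=
  (∀ j, b j ∈ D) ∧ n = b.sum fun j a => a * q ^ j

/-- The finiteness property: every algebraic integer has a finite base-`q` expansion. -/
def HasFiniteness (q : 𝓞 K) (D : Finset (𝓞 K)) : Prop :=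
  ∀ n : 𝓞 K, ∃ b : ℕ →₀ 𝓞 K, IsExpansion q D n b

/-- The canonical digit set `{0, 1, …, |N(q)| - 1}`. -/
def canonicalDigits (q : 𝓞 K) : Finset (𝓞 K) :=
  (Finset.range (absNorm q)).map Nat.castEmbedding

/-- `q` is the base of a canonical number system. -/
def IsCNSBase (q : 𝓞 K) : Prop := IsNumberSystem q (canonicalDigits q)

open Classical in
/-- The base-`q` expansion of `n` (zero when there is none). For a number system it is unique,
see `IsNumberSystem.expansion_unique`. -/
def expansion (q : 𝓞 K) (D : Finset (𝓞 K)) (n : 𝓞 K) : ℕ →₀ 𝓞 K :=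
  if h : ∃ b, IsExpansion q D n b then h.choose else 0

/-- `r_{ν,∞}(n) = ∑_{j ≥ ν} n_j q ^ (j - ν)`, the integer formed with the digits `n_j` of `n` of
indices `j ≥ ν`. -/
def digitTail (q : 𝓞 K) (D : Finset (𝓞 K)) (ν : ℕ) (n : 𝓞 K) : 𝓞 K :=
  (expansion q D n).sum fun j a => if ν ≤ j then a * q ^ (j - ν) else 0

/-- `N_κ`, the set of integers `∑_{j < κ} b_j q ^ j` with digits `b_j ∈ D`. -/
def truncatedIntegers (q : 𝓞 K) (D : Finset (𝓞 K)) (κ : ℕ) : Set (𝓞 K) :=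
  {n | ∃ b : ℕ → 𝓞 K, (∀ j, b j ∈ D) ∧ n = ∑ j ∈ Finset.range κ, b j * q ^ j}

/-- `η` is a carry constant of `(q, D)`: `η ∈ (0, 1]` and, uniformly in `0 ≤ ρ ≤ ν ≤ μ`, the number
of `m ∈ N_μ` such that `r_{ν,∞}(m + n) ≠ r_{ν,∞}(m)` for some `n ∈ N_{ν-ρ}` is
`≪ Q ^ (μ - η ρ)`. -/
def IsCarryConstant (q : 𝓞 K) (D : Finset (𝓞 K)) (η : ℝ) : Prop :=
  0 < η ∧ η ≤ 1 ∧ ∃ A : ℝ, ∀ ρ ν μ : ℕ, ρ ≤ ν → ν ≤ μ →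
    {m ∈ truncatedIntegers q D μ | ∃ n ∈ truncatedIntegers q D (ν - ρ),
        digitTail q D ν (m + n) ≠ digitTail q D ν m}.Finite ∧
    ({m ∈ truncatedIntegers q D μ | ∃ n ∈ truncatedIntegers q D (ν - ρ),
        digitTail q D ν (m + n) ≠ digitTail q D ν m}.ncard : ℝ)
      ≤ A * (absNorm q : ℝ) ^ ((μ : ℝ) - η * (ρ : ℝ))

/-- The fundamental tile in `K`: all `∑_{j=1}^r b_j q ^ (-j)` with `r ≥ 1` and `b_j ∈ D`. -/
def fundamentalTile (q : 𝓞 K) (D : Finset (𝓞 K)) : Set K :=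
  {x | ∃ r : ℕ, 1 ≤ r ∧ ∃ b : ℕ → 𝓞 K, (∀ j, b j ∈ D) ∧
    x = ∑ j ∈ Finset.Icc 1 r, (b j : K) * ((q : K) ^ j)⁻¹}

/-- The coordinate vector in `ℝ ^ d` of an element of `K`, with respect to a `ℤ`-basis `ω` of the
ring of integers (which is also a `ℚ`-basis of `K`). -/
def coordinates {d : ℕ} (ω : Module.Basis (Fin d) ℤ (𝓞 K)) (x : K) : EuclideanSpace ℝ (Fin d) :=
  WithLp.toLp 2 fun i =>
    (((ω.localizationLocalization ℚ (nonZeroDivisors ℤ) K).repr x i : ℚ) : ℝ)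

/-- The fundamental tile viewed in `ℝ ^ d`: the closure of its set of coordinate vectors. -/
def realTile {d : ℕ} (ω : Module.Basis (Fin d) ℤ (𝓞 K)) (q : 𝓞 K) (D : Finset (𝓞 K)) :
    Set (EuclideanSpace ℝ (Fin d)) :=
  closure (coordinates ω '' fundamentalTile q D)

theorem IsNumberSystem.ne_zero {q : 𝓞 K} {D : Finset (𝓞 K)} (h : IsNumberSystem q D) : q ≠ 0 := by
  rintro rfl
  obtain ⟨φ⟩ : Nonempty (K →+* ℂ) := inferInstance
  have := h.one_lt_norm_conj φ
  norm_num at this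

theorem isExpansion_iff_range {q : 𝓞 K} {D : Finset (𝓞 K)} {n : 𝓞 K} {b : ℕ →₀ 𝓞 K} {N : ℕ}
    (hN : ∀ j, N ≤ j → b j = 0) :
    IsExpansion q D n b ↔ (∀ j, b j ∈ D) ∧ n = ∑ j ∈ Finset.range N, b j * q ^ j := by
  unfold IsExpansion
  rw [Finsupp.sum_of_support_subset b (s := Finset.range N) _ _ (by simp)]
  intro j hj
  by_contra hc
  exact (Finsupp.mem_support_iff.mp hj) (hN j (by simpa using hc))

/-- Finite expansions in a number system are unique. -/
theorem IsNumberSystem.expansion_unique {q : 𝓞 K} {D : Finset (𝓞 K)} (h : IsNumberSystem q D)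
    {n : 𝓞 K} {b c : ℕ →₀ 𝓞 K} (hb : IsExpansion q D n b) (hc : IsExpansion q D n c) : b = c := by
  have key : ∀ (N : ℕ) (b c : ℕ → 𝓞 K), (∀ j, b j ∈ D) → (∀ j, c j ∈ D) →
      ∑ j ∈ Finset.range N, b j * q ^ j = ∑ j ∈ Finset.range N, c j * q ^ j →
      ∀ j < N, b j = c j := by
    intro N
    induction N with
    | zero => intro b c _ _ _ j hj; omega
    | succ N ih =>
      intro b c hb hc hs
      rw [Finset.sum_range_succ', Finset.sum_range_succ'] at hs
      have e : ∀ f : ℕ → 𝓞 K, ∑ k ∈ Finset.range N, f (k + 1) * q ^ (k + 1)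
          = q * ∑ k ∈ Finset.range N, f (k + 1) * q ^ k := by
        intro f
        rw [Finset.mul_sum]
        exact Finset.sum_congr rfl fun k _ => by ring
      rw [e b, e c] at hs
      simp only [pow_zero, mul_one] at hs
      have h0 : b 0 = c 0 := by
        refine (h.existsUnique_digit (b 0)).unique ⟨hb 0, by simp⟩ ⟨hc 0, ?_⟩
        exact ⟨∑ k ∈ Finset.range N, c (k + 1) * q ^ k
          - ∑ k ∈ Finset.range N, b (k + 1) * q ^ k, by linear_combination hs⟩
      rw [h0] at hs
      have hs' := mul_left_cancel₀ h.ne_zero (add_right_cancel hs)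
      intro j hj
      cases j with
      | zero => exact h0
      | succ j =>
        exact ih (fun k => b (k + 1)) (fun k => c (k + 1)) (fun k => hb _) (fun k => hc _) hs' j
          (by omega)
  obtain ⟨N, hNb⟩ : ∃ N, ∀ j, N ≤ j → b j = 0 ∧ c j = 0 := by
    refine ⟨(b.support ∪ c.support).sup id + 1, fun j hj => ?_⟩
    have : j ∉ b.support ∪ c.support := fun hm => by
      have := Finset.le_sup (f := id) hm
      simp only [id] at this
      omega
    simpa using this
  have hb' := (isExpansion_iff_range fun j hj => (hNb j hj).1).1 hb
  have hc' := (isExpansion_iff_range fun j hj => (hNb j hj).2).1 hc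
  ext1 j
  by_cases hj : j < N
  · exact key N b c hb'.1 hc'.1 (hb'.2.symm.trans hc'.2) j hj
  · rw [(hNb j (by omega)).1, (hNb j (by omega)).2]

theorem HasFiniteness.expansion_spec {q : 𝓞 K} {D : Finset (𝓞 K)} (h : HasFiniteness q D)
    (n : 𝓞 K) : IsExpansion q D n (expansion q D n) := by
  unfold expansion
  rw [dif_pos (h n)]
  exact (h n).choose_spec

end NumerationSystem

/-- The upper box dimension of a subset of a metric space: the upper limit of
`log N_ε(A) / log (1 / ε)` as `ε → 0+`, where `N_ε(A)` is the least number of closed balls of radius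
`ε` which cover `A`. -/
def upperBoxDim {X : Type*} [PseudoMetricSpace X] (A : Set X) : EReal :=
  Filter.limsup
    (fun ε : ℝ≥0 => ENNReal.log ((Metric.externalCoveringNumber ε A : ℕ∞) : ℝ≥0∞) /
      ((Real.log (1 / (ε : ℝ)) : ℝ) : EReal))
    (𝓝[>] 0)

end

set_option linter.unusedSectionVars false

/-! Both claims reduce to one count. Say that `t` of length `k` overflows for `s` if `t + s` no
longer has length `k`, and suppose that for each `s` there are `O(λ ^ k)` such `t`. Adding an
integer of length `ν - ρ` changes the digits from `ν` on only if the carry at position `ν - ρ`,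
bounded in all embeddings, makes the next block of `ρ` digits overflow. So every `η ∈ (0, 1]` with
`λ ≤ Q ^ (1 - η)` is a carry constant (`exists_isCarryConstant_of_ncard_overflow_le`). Likewise a
boundary point of the tile is a limit of points off the tile, so it lies near a level-`n` address
that overflows for a bounded `s`. Hence the boundary has dimension at most `log λ / log r`, where `r
> 1` bounds the conjugates of `q` from below (`upperBoxDim_frontier_realTile_le`).

The heart is that `λ = B * m ^ (d - 1)` is admissible with `B` independent of `m`
(`exists_ncard_overflow_translate_le`), against the trivial `Q ≍ m ^ d`. Let `P = ∑ p_j X ^ j` be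
the characteristic polynomial of multiplication by `q`, and `w_j` its truncations at `q`, so that
`w_j = q * w_{j+1} + p_j` and `w_0 = 0`. Write a carry as `∑ s_j w_{j+1}`. Reading a digit shifts
the coefficients one place and puts in front, up to sign, the quotient by `Q` of an integer linear
in `s`. Since `p_j = O(m ^ (d - j))`, the weight `∑ |s_j| m ^ (d - 1 - j)`, summed over all `Q`
digits, grows by a factor `O(m ^ (d - 1))` only.

For large `m` the conjugates have modulus at least `m / 2`, so `Q ≥ (m / 2) ^ d`, and taking
logarithms gives both bounds. If `1/d - C / log m ≤ 0`, any carry constant will do, and finiteness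
provides one (`exists_isCarryConstant`). In the dimension bound the finitely many small `m` are
absorbed into `C`. -/

/-! ### Box dimension from covers -/

open Filter in
/-- Covers of `S` by `O(B ^ n)` balls of radius `O(r ^ (-n))` bound its upper box dimension. -/
theorem upperBoxDim_le_of_cover {X : Type*} [PseudoMetricSpace X] {S : Set X} {r B c A : ℝ}
    (hr : 1 < r) (hB : 1 ≤ B) (hc : 0 < c) (hA : 1 ≤ A)
    (h : ∀ n : ℕ, ∃ T : Finset X, (T.card : ℝ) ≤ A * B ^ n ∧
      ∀ x ∈ S, ∃ t ∈ T, dist x t ≤ c * (r ^ n)⁻¹) :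
    upperBoxDim S ≤ ((Real.log B / Real.log r : ℝ) : EReal) := by
  have hlr : 0 < Real.log r := Real.log_pos hr
  have hlB : 0 ≤ Real.log B := Real.log_nonneg hB
  -- `a` collects what does not grow with `log (1 / ε)`: the factors `A` and `c`, and the loss of at
  -- most one in rounding `n` up.
  set a : ℝ := Real.log A + (Real.log c / Real.log r + 1) * Real.log B with ha
  have hy : Tendsto (fun ε : ℝ≥0 => Real.log (1 / (ε : ℝ))) (𝓝[>] 0) atTop := by
    have h1 : Tendsto (fun ε : ℝ≥0 => (ε : ℝ)) (𝓝[>] 0) (𝓝[>] 0) := by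
      refine tendsto_nhdsWithin_iff.2 ⟨?_, ?_⟩
      · exact (NNReal.continuous_coe.tendsto 0).mono_left nhdsWithin_le_nhds
      · filter_upwards [self_mem_nhdsWithin] with ε hε
        exact_mod_cast hε
    have h2 := Real.tendsto_log_atTop.comp (tendsto_inv_nhdsGT_zero.comp h1)
    simpa [Function.comp_def] using h2
  have hlim : Tendsto (fun ε : ℝ≥0 => (((a + Real.log B / Real.log r * Real.log (1 / (ε : ℝ))) /
      Real.log (1 / (ε : ℝ)) : ℝ) : EReal)) (𝓝[>] 0)
      (𝓝 ((Real.log B / Real.log r : ℝ) : EReal)) := by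
    refine (continuous_coe_real_ereal.tendsto _).comp ?_
    have h3 : Tendsto (fun y : ℝ => a / y + Real.log B / Real.log r) atTop
        (𝓝 (0 + Real.log B / Real.log r)) :=
      (tendsto_const_nhds.div_atTop tendsto_id).add_const _
    rw [zero_add] at h3
    refine (h3.comp hy).congr' ?_
    filter_upwards [hy.eventually_gt_atTop 0] with ε hε
    simp only [Function.comp_apply]
    rw [add_div a, mul_div_cancel_right₀ _ hε.ne']
  rw [upperBoxDim, ← hlim.limsup_eq]
  refine limsup_le_limsup ?_
  filter_upwards [hy.eventually_gt_atTop 0, hy.eventually_ge_atTop (-Real.log c),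
    self_mem_nhdsWithin] with ε hε hεc hε0
  have hε0' : (0 : ℝ) < ε := by exact_mod_cast hε0
  set y := Real.log (1 / (ε : ℝ)) with hyd
  have hεy : Real.log ε = -y := by rw [hyd, one_div, Real.log_inv, neg_neg]
  -- The least `n` with `c * r ^ (-n) ≤ ε`.
  set n := ⌈(Real.log c + y) / Real.log r⌉₊ with hn
  have hn1 : (Real.log c + y) / Real.log r ≤ n := Nat.le_ceil _
  have hn2 : (n : ℝ) ≤ (Real.log c + y) / Real.log r + 1 :=
    (Nat.ceil_lt_add_one (div_nonneg (by linarith) hlr.le)).le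
  obtain ⟨T, hT, hTS⟩ := h n
  have hle : c * (r ^ n)⁻¹ ≤ ε := by
    rw [← Real.log_le_log_iff (by positivity) hε0', Real.log_mul hc.ne' (by positivity),
      Real.log_inv, Real.log_pow, hεy]
    have := (div_le_iff₀ hlr).1 hn1
    linarith
  have hcov : Metric.IsCover ε S (T : Set X) := by
    rw [Metric.isCover_iff_subset_iUnion_closedBall]
    intro x hx
    obtain ⟨t, ht, hxt⟩ := hTS x hx
    exact Set.mem_biUnion (Finset.mem_coe.2 ht) (hxt.trans hle)
  have hnum : ((Metric.externalCoveringNumber ε S : ℕ∞) : ℝ≥0∞) ≤ ENNReal.ofReal (A * B ^ n) := by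
    have h1 := hcov.externalCoveringNumber_le_encard
    rw [Set.encard_coe_eq_coe_finsetCard] at h1
    calc _ ≤ (((T.card : ℕ) : ℕ∞) : ℝ≥0∞) := by exact_mod_cast h1
      _ = ENNReal.ofReal (T.card : ℝ) := by simp
      _ ≤ _ := ENNReal.ofReal_le_ofReal hT
  have hlog : ENNReal.log ((Metric.externalCoveringNumber ε S : ℕ∞) : ℝ≥0∞) ≤
      ((a + Real.log B / Real.log r * y : ℝ) : EReal) := by
    refine (ENNReal.log_monotone hnum).trans ?_
    rw [ENNReal.log_ofReal_of_pos (by positivity), EReal.coe_le_coe_iff,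
      Real.log_mul (by positivity) (by positivity), Real.log_pow]
    have := mul_le_mul_of_nonneg_right hn2 hlB
    calc _ ≤ Real.log A + ((Real.log c + y) / Real.log r + 1) * Real.log B := by linarith
      _ = _ := by rw [ha]; ring
  rw [EReal.coe_div]
  exact EReal.div_le_div_right_of_nonneg (by exact_mod_cast hε.le) hlog

namespace NumerationSystem

variable {K : Type*} [Field K] [NumberField K]

/-! ### Splitting and joining blocks of digits -/

theorem truncatedIntegers_zero (q : 𝓞 K) {D : Finset (𝓞 K)} (h0 : (0 : 𝓞 K) ∈ D) :
    truncatedIntegers q D 0 = {0} := by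
  ext x
  simp only [truncatedIntegers, Finset.range_zero, Finset.sum_empty, Set.mem_ofPred_eq,
    Set.mem_singleton_iff]
  exact ⟨fun ⟨_, _, h⟩ => h, fun h => ⟨fun _ => 0, fun _ => h0, h⟩⟩

theorem add_mem_truncatedIntegers {q : 𝓞 K} {D : Finset (𝓞 K)} {k l : ℕ} {t u : 𝓞 K}
    (ht : t ∈ truncatedIntegers q D k) (hu : u ∈ truncatedIntegers q D l) :
    t + q ^ k * u ∈ truncatedIntegers q D (k + l) := by
  obtain ⟨b, hb, rfl⟩ := ht
  obtain ⟨c, hc, rfl⟩ := hu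
  refine ⟨fun j => if j < k then b j else c (j - k), fun j => ?_, ?_⟩
  · dsimp only
    split_ifs
    exacts [hb j, hc _]
  · rw [Finset.sum_range_add, Finset.mul_sum]
    congr 1
    · exact Finset.sum_congr rfl fun j hj => by
        dsimp only; rw [if_pos (Finset.mem_range.1 hj)]
    · refine Finset.sum_congr rfl fun j _ => ?_
      dsimp only
      rw [if_neg (by omega), Nat.add_sub_cancel_left, pow_add]
      ring

theorem exists_split_of_mem_truncatedIntegers {q : 𝓞 K} {D : Finset (𝓞 K)} {k l : ℕ} {t : 𝓞 K}
    (ht : t ∈ truncatedIntegers q D (k + l)) :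
    ∃ u ∈ truncatedIntegers q D k, ∃ v ∈ truncatedIntegers q D l, t = u + q ^ k * v := by
  obtain ⟨b, hb, rfl⟩ := ht
  refine ⟨_, ⟨b, hb, rfl⟩, _, ⟨fun j => b (k + j), fun j => hb _, rfl⟩, ?_⟩
  rw [Finset.sum_range_add, Finset.mul_sum]
  congr 1
  exact Finset.sum_congr rfl fun j _ => by rw [pow_add]; ring

theorem zero_mem_truncatedIntegers (q : 𝓞 K) {D : Finset (𝓞 K)} (h0 : (0 : 𝓞 K) ∈ D) (k : ℕ) :
    (0 : 𝓞 K) ∈ truncatedIntegers q D k :=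
  ⟨fun _ => 0, fun _ => h0, by simp⟩

theorem truncatedIntegers_mono (q : 𝓞 K) {D : Finset (𝓞 K)} (h0 : (0 : 𝓞 K) ∈ D) :
    Monotone (truncatedIntegers q D) := by
  intro k l hkl t ht
  obtain ⟨j, rfl⟩ := Nat.exists_eq_add_of_le hkl
  simpa using add_mem_truncatedIntegers ht (zero_mem_truncatedIntegers q h0 j)

theorem mem_truncatedIntegers_one {q : 𝓞 K} {D : Finset (𝓞 K)} {t : 𝓞 K} :
    t ∈ truncatedIntegers q D 1 ↔ t ∈ D := by
  simp only [truncatedIntegers, Finset.range_one, Finset.sum_singleton, pow_zero, mul_one,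
    Set.mem_ofPred_eq]
  exact ⟨fun ⟨b, hb, h⟩ => h ▸ hb 0, fun h => ⟨fun _ => t, fun _ => h, rfl⟩⟩

/-- The integers of length `k` are pairwise incongruent modulo `q ^ k`. -/
theorem IsNumberSystem.eq_of_add_pow_mul_eq {q : 𝓞 K} {D : Finset (𝓞 K)}
    (h : IsNumberSystem q D) {k : ℕ} {u u' v v' : 𝓞 K} (hu : u ∈ truncatedIntegers q D k)
    (hu' : u' ∈ truncatedIntegers q D k) (e : u + q ^ k * v = u' + q ^ k * v') :
    u = u' ∧ v = v' := by
  induction k generalizing u u' v v' with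
  | zero =>
    rw [truncatedIntegers_zero q h.zero_mem, Set.mem_singleton_iff] at hu hu'
    subst hu hu'
    simpa using e
  | succ k ih =>
    obtain ⟨a, ha, b, hb, rfl⟩ := exists_split_of_mem_truncatedIntegers hu
    obtain ⟨a', ha', b', hb', rfl⟩ := exists_split_of_mem_truncatedIntegers hu'
    obtain ⟨rfl, e2⟩ := ih (v := b + q * v) (v' := b' + q * v') ha ha'
      (by linear_combination e)
    rw [mem_truncatedIntegers_one] at hb hb'
    have hbb : b = b' := by
      refine (h.existsUnique_digit b).unique ⟨hb, by simp⟩ ⟨hb', ⟨v' - v, ?_⟩⟩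
      linear_combination e2
    subst hbb
    exact ⟨rfl, mul_left_cancel₀ h.ne_zero (add_left_cancel e2)⟩

theorem truncatedIntegers_finite (q : 𝓞 K) {D : Finset (𝓞 K)} (h0 : (0 : 𝓞 K) ∈ D) (k : ℕ) :
    (truncatedIntegers q D k).Finite ∧ (truncatedIntegers q D k).ncard ≤ D.card ^ k := by
  induction k with
  | zero => simp [truncatedIntegers_zero q h0]
  | succ k ih =>
    have hsub : truncatedIntegers q D (k + 1) ⊆
        (fun p : 𝓞 K × 𝓞 K => p.1 + q ^ k * p.2) '' (truncatedIntegers q D k ×ˢ (D : Set (𝓞 K))) := by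
      intro t ht
      obtain ⟨u, hu, v, hv, rfl⟩ := exists_split_of_mem_truncatedIntegers ht
      exact ⟨(u, v), ⟨hu, mem_truncatedIntegers_one.1 hv⟩, rfl⟩
    have hfin := ih.1.prod D.finite_toSet
    refine ⟨(hfin.image _).subset hsub, ?_⟩
    calc _ ≤ _ := Set.ncard_le_ncard hsub (hfin.image _)
      _ ≤ _ := Set.ncard_image_le hfin
      _ = (truncatedIntegers q D k).ncard * D.card := by
        rw [Set.ncard_prod, Set.ncard_coe_finset]
      _ ≤ _ := by rw [pow_succ]; exact Nat.mul_le_mul_right _ ih.2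

theorem card_canonicalDigits (q : 𝓞 K) : (canonicalDigits q).card = absNorm q := by
  simp [canonicalDigits]

theorem HasFiniteness.exists_eq_add_digitTail {q : 𝓞 K} {D : Finset (𝓞 K)}
    (hf : HasFiniteness q D) (k : ℕ) (x : 𝓞 K) :
    ∃ u ∈ truncatedIntegers q D k, x = u + q ^ k * digitTail q D k x := by
  obtain ⟨hD, hs⟩ := hf.expansion_spec x
  set b := expansion q D x with hb
  refine ⟨_, ⟨b, hD, rfl⟩, ?_⟩
  have hl : ∑ j ∈ Finset.range k, b j * q ^ j =
      b.sum fun j a => if j < k then a * q ^ j else 0 := by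
    rw [Finsupp.sum, ← Finset.sum_filter]
    refine (Finset.sum_subset ?_ ?_).symm
    · intro j hj
      simpa using (Finset.mem_filter.1 hj).2
    · intro j hj hj'
      have : b j = 0 := by
        by_contra hne
        exact hj' (Finset.mem_filter.2 ⟨Finsupp.mem_support_iff.2 hne, Finset.mem_range.1 hj⟩)
      rw [this, zero_mul]
  rw [hl, digitTail, ← hb, Finsupp.mul_sum, ← Finsupp.sum_add]
  conv_lhs => rw [hs]
  refine Finsupp.sum_congr fun j _ => ?_
  rcases le_or_gt k j with hj | hj
  · rw [if_neg (by omega), if_pos hj, zero_add, mul_left_comm, ← pow_add, Nat.add_sub_cancel' hj]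
  · rw [if_pos hj, if_neg (by omega), mul_zero, add_zero]

/-- By uniqueness modulo `q ^ k`, any decomposition of this shape is the digit split. Below,
`digitTail` is handled only through this and `HasFiniteness.exists_eq_add_digitTail`. -/
theorem IsNumberSystem.digitTail_add_pow_mul {q : 𝓞 K} {D : Finset (𝓞 K)}
    (h : IsNumberSystem q D) (hf : HasFiniteness q D) {k : ℕ} {u : 𝓞 K}
    (hu : u ∈ truncatedIntegers q D k) (v : 𝓞 K) : digitTail q D k (u + q ^ k * v) = v := by
  obtain ⟨u', hu', e⟩ := hf.exists_eq_add_digitTail k (u + q ^ k * v)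
  exact (h.eq_of_add_pow_mul_eq hu hu' e).2.symm

theorem HasFiniteness.exists_mem_truncatedIntegers {q : 𝓞 K} {D : Finset (𝓞 K)}
    (hf : HasFiniteness q D) (x : 𝓞 K) : ∃ k, x ∈ truncatedIntegers q D k := by
  obtain ⟨b, hb⟩ := hf x
  have hN : ∀ j, b.support.sup id + 1 ≤ j → b j = 0 := by
    intro j hj
    by_contra hc
    have := Finset.le_sup (f := id) (Finsupp.mem_support_iff.2 hc)
    simp only [id] at this
    omega
  exact ⟨_, b, (isExpansion_iff_range hN).1 hb⟩

/-! ### Size of conjugates -/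

theorem exists_one_lt_le_norm {q : 𝓞 K} {D : Finset (𝓞 K)} (h : IsNumberSystem q D) :
    ∃ r : ℝ, 1 < r ∧ ∀ φ : K →+* ℂ, r ≤ ‖φ (q : K)‖ := by
  obtain ⟨φ₀, h₀⟩ := Finite.exists_min fun φ : K →+* ℂ => ‖φ (q : K)‖
  exact ⟨_, h.one_lt_norm_conj φ₀, h₀⟩

/-- Conjugates of integers of length `k` are bounded by a constant times those of `q ^ k`. -/
theorem exists_norm_le_of_mem_truncatedIntegers {q : 𝓞 K} {D : Finset (𝓞 K)}
    (h : IsNumberSystem q D) :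
    ∃ c : ℝ, 0 ≤ c ∧ ∀ (φ : K →+* ℂ) (k : ℕ), ∀ t ∈ truncatedIntegers q D k,
      ‖φ (t : K)‖ ≤ c * ‖φ (q : K)‖ ^ k := by
  obtain ⟨r, hr, hrφ⟩ := exists_one_lt_le_norm h
  set δ : ℝ := ∑ φ : K →+* ℂ, ∑ b ∈ D, ‖φ (b : K)‖
  have hδ0 : 0 ≤ δ := by positivity
  have hδ : ∀ (φ : K →+* ℂ), ∀ b ∈ D, ‖φ (b : K)‖ ≤ δ := fun φ b hb =>
    (Finset.single_le_sum (f := fun b : 𝓞 K => ‖φ (b : K)‖) (fun _ _ => norm_nonneg _) hb).trans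
      (Finset.single_le_sum (f := fun φ : K →+* ℂ => ∑ b ∈ D, ‖φ (b : K)‖)
        (fun _ _ => by positivity) (Finset.mem_univ φ))
  have hr0 : 0 < r - 1 := by linarith
  -- A geometric series: `c = δ / (r - 1)` satisfies `c + δ ≤ c * ‖φ q‖`, which is the induction
  -- step.
  refine ⟨δ / (r - 1), by positivity, fun φ k => ?_⟩
  induction k with
  | zero =>
    intro t ht
    rw [truncatedIntegers_zero q h.zero_mem, Set.mem_singleton_iff] at ht
    subst ht
    simp only [map_zero, norm_zero]
    positivity
  | succ k ih =>
    intro t ht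
    obtain ⟨u, hu, b, hb, rfl⟩ := exists_split_of_mem_truncatedIntegers ht
    have h1 := ih u hu
    have h2 := hδ φ b (mem_truncatedIntegers_one.1 hb)
    have h3 : δ ≤ δ / (r - 1) * (‖φ (q : K)‖ - 1) := by
      rw [div_mul_eq_mul_div, le_div_iff₀ hr0]
      exact mul_le_mul_of_nonneg_left (by linarith [hrφ φ]) hδ0
    have hp : 0 ≤ ‖φ (q : K)‖ ^ k := by positivity
    calc ‖φ ((u + q ^ k * b : 𝓞 K) : K)‖ ≤ ‖φ (u : K)‖ + ‖φ (q : K)‖ ^ k * ‖φ (b : K)‖ := by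
          simp only [map_add, map_mul, map_pow]
          exact (norm_add_le _ _).trans (by rw [norm_mul, norm_pow])
      _ ≤ δ / (r - 1) * ‖φ (q : K)‖ ^ k +
          ‖φ (q : K)‖ ^ k * (δ / (r - 1) * (‖φ (q : K)‖ - 1)) := by
        gcongr
        exact h2.trans h3
      _ = _ := by ring

theorem finite_setOf_norm_le (R : ℝ) : {s : 𝓞 K | ∀ φ : K →+* ℂ, ‖φ (s : K)‖ ≤ R}.Finite := by
  refine Set.Finite.of_finite_image (f := fun s : 𝓞 K => (s : K)) ?_
    (NumberField.RingOfIntegers.coe_injective.injOn)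
  refine (NumberField.Embeddings.finite_of_norm_le K ℂ R).subset ?_
  rintro _ ⟨s, hs, rfl⟩
  exact ⟨s.isIntegral_coe, hs⟩

theorem absNorm_eq_prod_norm (q : 𝓞 K) : (absNorm q : ℝ) = ∏ φ : K →+* ℂ, ‖φ (q : K)‖ := by
  have h1 := Algebra.norm_eq_prod_embeddings ℚ ℂ (q : K)
  rw [← Algebra.coe_norm_int q] at h1
  have h2 := congrArg norm h1
  rw [norm_prod] at h2
  rw [← Equiv.prod_comp (RingHom.equivRatAlgHom (R := K) (S := ℂ)).symm]
  refine Eq.trans ?_ h2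
  simp [absNorm]

theorem IsNumberSystem.two_le_absNorm {q : 𝓞 K} {D : Finset (𝓞 K)} (h : IsNumberSystem q D) :
    2 ≤ absNorm q := by
  have : (1 : ℝ) < absNorm q := by
    rw [absNorm_eq_prod_norm]
    simpa using Finset.prod_lt_prod_of_nonempty (s := Finset.univ)
      (f := fun _ : K →+* ℂ => (1 : ℝ)) (fun _ _ => one_pos)
      (fun φ _ => h.one_lt_norm_conj φ) Finset.univ_nonempty
  exact_mod_cast this

/-! ### Overflows and general exponential bounds -/

/-- The integers `t` of length `k` for which `t + s` does not have length `k`. -/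
def overflow (q : 𝓞 K) (D : Finset (𝓞 K)) (k : ℕ) (s : 𝓞 K) : Set (𝓞 K) :=
  {t ∈ truncatedIntegers q D k | t + s ∉ truncatedIntegers q D k}

theorem overflow_finite (q : 𝓞 K) {D : Finset (𝓞 K)} (h0 : (0 : 𝓞 K) ∈ D) (k : ℕ) (s : 𝓞 K) :
    (overflow q D k s).Finite :=
  (truncatedIntegers_finite q h0 k).1.subset fun _ h => h.1

theorem ncard_overflow_le (q : 𝓞 K) {D : Finset (𝓞 K)} (h0 : (0 : 𝓞 K) ∈ D) (k : ℕ) (s : 𝓞 K) :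
    (overflow q D k s).ncard ≤ D.card ^ k :=
  (Set.ncard_le_ncard (fun _ h => h.1) (truncatedIntegers_finite q h0 k).1).trans
    (truncatedIntegers_finite q h0 k).2

theorem overflow_zero_right (q : 𝓞 K) (D : Finset (𝓞 K)) (k : ℕ) : overflow q D k 0 = ∅ := by
  ext t
  simp [overflow]

/-- If the lower block absorbs `s`, no carry reaches the upper block. So an overflow of length `l +
k` is an overflow `t` of length `l` followed by an overflow of length `k` for the carry out of `t +
s`. Both exponential bounds iterate this. -/
theorem ncard_overflow_add_le {q : 𝓞 K} {D : Finset (𝓞 K)} (h : IsNumberSystem q D)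
    (hf : HasFiniteness q D) (l k : ℕ) (s : 𝓞 K) :
    (overflow q D (l + k) s).ncard ≤ ∑ t ∈ (overflow_finite q h.zero_mem l s).toFinset,
      (overflow q D k (digitTail q D l (t + s))).ncard := by
  classical
  have hfin := fun t : 𝓞 K =>
    ((overflow_finite q h.zero_mem k (digitTail q D l (t + s))).image fun v => t + q ^ l * v)
  have hsub : overflow q D (l + k) s ⊆ ((overflow_finite q h.zero_mem l s).toFinset.biUnion
      fun t => (hfin t).toFinset : Finset (𝓞 K)) := by
    rintro x ⟨hx, hxs⟩
    obtain ⟨t, ht, v, hv, rfl⟩ := exists_split_of_mem_truncatedIntegers hx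
    obtain ⟨u, hu, e⟩ := hf.exists_eq_add_digitTail l (t + s)
    have key : v + digitTail q D l (t + s) ∉ truncatedIntegers q D k := fun hc => hxs <| by
      rw [show t + q ^ l * v + s = u + q ^ l * (v + digitTail q D l (t + s)) by
        linear_combination e]
      exact add_mem_truncatedIntegers hu hc
    simp only [Finset.coe_biUnion, Set.Finite.coe_toFinset, Set.mem_iUnion]
    refine ⟨t, ⟨ht, fun hc => key ?_⟩, v, ⟨hv, key⟩, rfl⟩
    have h0 := h.digitTail_add_pow_mul hf hc 0
    rw [mul_zero, add_zero] at h0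
    rwa [h0, add_zero]
  calc _ ≤ _ := Set.ncard_le_ncard hsub (Finset.finite_toSet _)
    _ ≤ _ := by
      rw [Set.ncard_coe_finset]
      refine Finset.card_biUnion_le.trans (Finset.sum_le_sum fun t _ => ?_)
      rw [← Set.ncard_eq_toFinset_card _ (hfin t)]
      exact Set.ncard_image_le (overflow_finite q h.zero_mem k _)

/-- A weight on representatives of carries which is multiplied on average by `B` when a digit is
read bounds the number of overflows. -/
theorem ncard_overflow_le_of_weight {q : 𝓞 K} {D : Finset (𝓞 K)} (h : IsNumberSystem q D)
    (hf : HasFiniteness q D) {σ : Type*} (eval : σ → 𝓞 K) (next : σ → 𝓞 K → σ) (V : σ → ℝ)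
    {B : ℝ} (hB : 0 ≤ B) (hV : ∀ s, 0 ≤ V s) (hV1 : ∀ s, eval s ≠ 0 → 1 ≤ V s)
    (hnext : ∀ s, ∀ b ∈ D, ∃ b' ∈ D, b + eval s = b' + q * eval (next s b))
    (hsum : ∀ s, ∑ b ∈ D, V (next s b) ≤ B * V s) (k : ℕ) (s : σ) :
    ((overflow q D k (eval s)).ncard : ℝ) ≤ V s * B ^ k := by
  induction k generalizing s with
  | zero =>
    -- At length `0` only `0` can overflow, and only for a nonzero carry; this is where `hV1`
    -- enters.
    by_cases hs : eval s = 0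
    · simpa [hs, overflow_zero_right] using hV s
    · have := ncard_overflow_le q h.zero_mem 0 (eval s)
      rw [pow_zero, mul_one]
      rw [pow_zero] at this
      exact le_trans (by exact_mod_cast this) (hV1 s hs)
  | succ k ih =>
    have h1 := ncard_overflow_add_le h hf 1 k (eval s)
    have h2 : ((overflow q D (1 + k) (eval s)).ncard : ℝ) ≤
        ∑ t ∈ (overflow_finite q h.zero_mem 1 (eval s)).toFinset,
          ((overflow q D k (digitTail q D 1 (t + eval s))).ncard : ℝ) := by
      exact_mod_cast h1
    rw [add_comm k 1]
    have hsub : (overflow_finite q h.zero_mem 1 (eval s)).toFinset ⊆ D := fun t ht =>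
      mem_truncatedIntegers_one.1 ((Set.Finite.mem_toFinset _).1 ht).1
    calc _ ≤ _ := h2
      _ ≤ ∑ b ∈ D, ((overflow q D k (digitTail q D 1 (b + eval s))).ncard : ℝ) :=
        Finset.sum_le_sum_of_subset_of_nonneg hsub fun _ _ _ => Nat.cast_nonneg _
      _ ≤ ∑ b ∈ D, V (next s b) * B ^ k := by
        refine Finset.sum_le_sum fun b hb => ?_
        obtain ⟨b', hb', e⟩ := hnext s b hb
        have := h.digitTail_add_pow_mul hf (mem_truncatedIntegers_one.2 hb') (eval (next s b))
        rw [pow_one, ← e] at this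
        rw [this]
        exact ih _
      _ = (∑ b ∈ D, V (next s b)) * B ^ k := by rw [Finset.sum_mul]
      _ ≤ B * V s * B ^ k := mul_le_mul_of_nonneg_right (hsum s) (by positivity)
      _ = _ := by ring

/-- Carries of bounded integers are bounded. -/
theorem exists_norm_digitTail_le {q : 𝓞 K} {D : Finset (𝓞 K)} (h : IsNumberSystem q D)
    (hf : HasFiniteness q D) (R₀ : ℝ) :
    ∃ R : ℝ, R₀ ≤ R ∧ ∀ s : 𝓞 K, (∀ φ : K →+* ℂ, ‖φ (s : K)‖ ≤ R) → ∀ l, 1 ≤ l →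
      ∀ t ∈ truncatedIntegers q D l, ∀ φ : K →+* ℂ, ‖φ (digitTail q D l (t + s) : K)‖ ≤ R := by
  obtain ⟨r, hr, hrφ⟩ := exists_one_lt_le_norm h
  obtain ⟨c, hc, hcφ⟩ := exists_norm_le_of_mem_truncatedIntegers h
  have hr1 : 0 < r - 1 := by linarith
  -- This `R` satisfies `2 * c + R / x ≤ R` for all `x ≥ r`; with `x = ‖φ q‖ ^ l` the left side
  -- bounds the new carry.
  refine ⟨max R₀ (2 * c * r / (r - 1)), le_max_left _ _, fun s hs l hl t ht φ => ?_⟩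
  set R := max R₀ (2 * c * r / (r - 1))
  have hR : 2 * c * r ≤ R * (r - 1) := (div_le_iff₀ hr1).1 (le_max_right _ _)
  have hR0 : 0 ≤ R := le_trans (by positivity) (le_max_right R₀ (2 * c * r / (r - 1)))
  obtain ⟨u, hu, e⟩ := hf.exists_eq_add_digitTail l (t + s)
  set v := digitTail q D l (t + s)
  have e' : φ (q : K) ^ l * φ (v : K) = φ (t : K) + φ (s : K) - φ (u : K) := by
    have := congrArg (fun x : 𝓞 K => φ (x : K)) e
    simp only [map_add, map_mul, map_pow] at this
    rw [this]; ring
  have hq : r ≤ ‖φ (q : K)‖ ^ l :=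
    (hrφ φ).trans (le_self_pow₀ ((h.one_lt_norm_conj φ).le) (by omega))
  set x := ‖φ (q : K)‖ ^ l
  have h1 : x * ‖φ (v : K)‖ ≤ c * x + R + c * x := by
    calc _ = ‖φ (q : K) ^ l * φ (v : K)‖ := by rw [norm_mul, norm_pow]
      _ ≤ ‖φ (t : K)‖ + ‖φ (s : K)‖ + ‖φ (u : K)‖ := by
        rw [e']
        exact (norm_sub_le _ _).trans (add_le_add_left (norm_add_le _ _) _)
      _ ≤ _ := add_le_add (add_le_add (hcφ φ l t ht) (hs φ)) (hcφ φ l u hu)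
  have hx : 0 < x := by linarith
  have h2 : 2 * c * x + R ≤ R * x := by
    have : 2 * c * r * x ≤ R * (r - 1) * x := mul_le_mul_of_nonneg_right hR hx.le
    have h3 : R * r ≤ R * x := mul_le_mul_of_nonneg_left hq hR0
    have h4 : r * (2 * c * x + R) ≤ r * (R * x) := by linarith
    exact le_of_mul_le_mul_left h4 (by linarith)
  refine le_of_mul_le_mul_left ?_ hx
  linarith

/-- The carries that can occur form a finite set, so by finiteness they have a common length `L`.
Then `0` never overflows at length `L`: each block of `L` digits has at most `D.card ^ L - 1`
overflows, and `lam` is the `L`-th root of this number. -/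
theorem exists_ncard_overflow_le {q : 𝓞 K} {D : Finset (𝓞 K)} (h : IsNumberSystem q D)
    (hf : HasFiniteness q D) (hD : 2 ≤ D.card) (R₀ : ℝ) :
    ∃ lam A : ℝ, 1 ≤ lam ∧ lam < D.card ∧ 0 ≤ A ∧ ∀ k, ∀ s : 𝓞 K,
      (∀ φ : K →+* ℂ, ‖φ (s : K)‖ ≤ R₀) → ((overflow q D k s).ncard : ℝ) ≤ A * lam ^ k := by
  obtain ⟨R, hR, hRS⟩ := exists_norm_digitTail_le h hf R₀
  set S : Set (𝓞 K) := {s | ∀ φ : K →+* ℂ, ‖φ (s : K)‖ ≤ R} with hS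
  have hSf : S.Finite := finite_setOf_norm_le R
  choose g hg using hf.exists_mem_truncatedIntegers
  set L := hSf.toFinset.sup g + 1
  have hL : ∀ s ∈ S, s ∈ truncatedIntegers q D L := fun s hs =>
    truncatedIntegers_mono q h.zero_mem
      ((Finset.le_sup (f := g) (hSf.mem_toFinset.2 hs)).trans (Nat.le_succ _)) (hg s)
  have hcard : ∀ s ∈ S, (overflow q D L s).ncard + 1 ≤ D.card ^ L := by
    intro s hs
    refine (Set.ncard_lt_ncard ?_ (truncatedIntegers_finite q h.zero_mem L).1).trans_le
      (truncatedIntegers_finite q h.zero_mem L).2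
    refine ⟨fun _ ht => ht.1, fun hc => ?_⟩
    have := (hc (zero_mem_truncatedIntegers q h.zero_mem L)).2
    rw [zero_add] at this
    exact this (hL s hs)
  have hL0 : L ≠ 0 := Nat.succ_ne_zero _
  have hD2 : (2 : ℝ) ≤ D.card := by exact_mod_cast hD
  set M : ℝ := (D.card : ℝ) ^ L - 1 with hM
  have hM1 : 1 ≤ M := by
    have := le_self_pow₀ (show (1 : ℝ) ≤ D.card by linarith) hL0
    linarith
  set lam : ℝ := M ^ ((L : ℝ)⁻¹) with hlam
  have hlamL : lam ^ L = M := Real.rpow_inv_natCast_pow (by linarith) hL0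
  have hlam1 : 1 ≤ lam := Real.one_le_rpow hM1 (by positivity)
  have hlamD : lam < D.card := by
    refine lt_of_pow_lt_pow_left₀ L (by positivity) ?_
    rw [hlamL]
    linarith
  -- The constant `D.card ^ L` covers the lengths `k < L`, where only the trivial bound is
  -- available.
  refine ⟨lam, (D.card : ℝ) ^ L, hlam1, hlamD, by positivity, fun k s hs => ?_⟩
  have hsS : s ∈ S := fun φ => (hs φ).trans hR
  clear hs
  induction k using Nat.strong_induction_on generalizing s with
  | _ k ih =>
  rcases lt_or_ge k L with hk | hk
  · have h1 : ((overflow q D k s).ncard : ℝ) ≤ (D.card : ℝ) ^ k := by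
      exact_mod_cast ncard_overflow_le q h.zero_mem k s
    have h2 : (D.card : ℝ) ^ k ≤ (D.card : ℝ) ^ L := pow_le_pow_right₀ (by linarith) hk.le
    exact (h1.trans h2).trans (le_mul_of_one_le_right (by positivity) (one_le_pow₀ hlam1))
  · obtain ⟨j, rfl⟩ := Nat.exists_eq_add_of_le hk
    have h1 := ncard_overflow_add_le h hf L j s
    calc ((overflow q D (L + j) s).ncard : ℝ)
        ≤ ∑ t ∈ (overflow_finite q h.zero_mem L s).toFinset,
          ((overflow q D j (digitTail q D L (t + s))).ncard : ℝ) := by exact_mod_cast h1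
      _ ≤ ∑ t ∈ (overflow_finite q h.zero_mem L s).toFinset, (D.card : ℝ) ^ L * lam ^ j := by
        refine Finset.sum_le_sum fun t ht => ih j (by omega) _ ?_
        exact hRS s hsS L (by omega) t ((Set.Finite.mem_toFinset _).1 ht).1
      _ = (overflow q D L s).ncard * ((D.card : ℝ) ^ L * lam ^ j) := by
        rw [Finset.sum_const, nsmul_eq_mul,
          ← Set.ncard_eq_toFinset_card _ (overflow_finite q h.zero_mem L s)]
      _ ≤ M * ((D.card : ℝ) ^ L * lam ^ j) := by
        refine mul_le_mul_of_nonneg_right ?_ (by positivity)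
        have : ((overflow q D L s).ncard : ℝ) + 1 ≤ (D.card : ℝ) ^ L := by
          exact_mod_cast hcard s hsS
        linarith
      _ = _ := by rw [pow_add lam, hlamL, mul_left_comm]

/-! ### The carry automaton of a canonical number system -/

/-- No quotient has sign opposite to `e`, and the quotients sum to exactly `e`. Thus no rounding
error of order `Q` enters the weight estimate. -/
theorem sum_range_abs_add_ediv_le {Q : ℕ} (hQ : 0 < Q) (e : ℤ) :
    ∑ n ∈ Finset.range Q, |((n : ℤ) + e) / Q| ≤ |e| := by
  have hQ' : (0 : ℤ) < Q := by exact_mod_cast hQ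
  have hsum : ∀ e : ℤ, ∑ n ∈ Finset.range Q, ((n : ℤ) + e) / Q = e := by
    -- Passing from `e` to `e + 1` drops the term `n = 0` and adds the term `n = Q`, which is larger
    -- by one.
    have step : ∀ e : ℤ, ∑ n ∈ Finset.range Q, ((n : ℤ) + (e + 1)) / Q =
        ∑ n ∈ Finset.range Q, ((n : ℤ) + e) / Q + 1 := by
      intro e
      have h1 := Finset.sum_range_succ (fun n : ℕ => ((n : ℤ) + e) / Q) Q
      rw [Finset.sum_range_succ'] at h1
      rw [Int.add_ediv_of_dvd_left (dvd_refl _), Int.ediv_self hQ'.ne'] at h1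
      push_cast at h1
      simp only [zero_add, add_right_comm _ (1 : ℤ) e] at h1
      simp only [← add_assoc] at h1 ⊢
      linarith
    intro e
    induction e using Int.induction_on with
    | zero =>
      refine Finset.sum_eq_zero fun n hn => ?_
      rw [add_zero]
      exact Int.ediv_eq_zero_of_lt (by positivity) (by exact_mod_cast Finset.mem_range.1 hn)
    | succ i ih => rw [step, ih]
    | pred i ih =>
      have := step (-(i : ℤ) - 1)
      rw [sub_add_cancel, ih] at this
      linarith
  rcases le_total 0 e with he | he
  · rw [abs_of_nonneg he]
    refine le_of_eq (Eq.trans (Finset.sum_congr rfl fun n _ => ?_) (hsum e))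
    exact abs_of_nonneg (Int.ediv_nonneg (by positivity) hQ'.le)
  · rw [abs_of_nonpos he]
    refine le_of_eq (Eq.trans (Finset.sum_congr rfl fun n hn => ?_)
      ((Finset.sum_neg_distrib _).trans (congrArg Neg.neg (hsum e))))
    refine abs_of_nonpos ?_
    have hn : (n : ℤ) < Q := by exact_mod_cast Finset.mem_range.1 hn
    exact Int.lt_add_one_iff.1 (Int.ediv_lt_of_lt_mul hQ' (by linarith))

open Polynomial in
/-- The polynomials `P = ∑ c_i X ^ i` truncated to `∑_{i ≥ j} c_i X ^ (i - j)`, evaluated at `q`. -/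
noncomputable def truncatedEval (P : ℤ[X]) (q : 𝓞 K) (j : ℕ) : 𝓞 K := aeval q (divX^[j] P)

open Polynomial in
theorem coeff_divX_iterate (P : ℤ[X]) (j n : ℕ) : (divX^[j] P).coeff n = P.coeff (n + j) := by
  induction j generalizing P with
  | zero => rfl
  | succ j ih => rw [Function.iterate_succ_apply, ih, coeff_divX, add_assoc]

open Polynomial in
theorem truncatedEval_eq (P : ℤ[X]) (q : 𝓞 K) (j : ℕ) :
    truncatedEval P q j = q * truncatedEval P q (j + 1) + (P.coeff j : ℤ) := by
  unfold truncatedEval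
  conv_lhs => rw [← divX_mul_X_add (divX^[j] P)]
  rw [Function.iterate_succ_apply', coeff_divX_iterate, zero_add]
  simp [mul_comm]

open Polynomial in
theorem truncatedEval_natDegree {P : ℤ[X]} (hP : P.Monic) (q : 𝓞 K) :
    truncatedEval P q P.natDegree = 1 := by
  have : divX^[P.natDegree] P = 1 := by
    ext n
    rw [coeff_divX_iterate, coeff_one]
    split_ifs with h
    · rw [h, zero_add]; exact hP
    · exact coeff_eq_zero_of_natDegree_lt (by omega)
  simp [truncatedEval, this]

open Polynomial in
theorem truncatedEval_of_natDegree_lt {P : ℤ[X]} {j : ℕ} (hj : P.natDegree < j) (q : 𝓞 K) :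
    truncatedEval P q j = 0 := by
  have : divX^[j] P = 0 := by
    ext n
    rw [coeff_divX_iterate, coeff_zero]
    exact coeff_eq_zero_of_natDegree_lt (by omega)
  simp [truncatedEval, this]

open Polynomial in
/-- The linear combination `∑_{j < d} s_j w_{j + 1}` of the values `w_j` of `truncatedEval`. -/
noncomputable def carryEval (P : ℤ[X]) (q : 𝓞 K) (d : ℕ) (s : ℕ → ℤ) : 𝓞 K :=
  ∑ j ∈ Finset.range d, (s j : 𝓞 K) * truncatedEval P q (j + 1)

-- Multiplication by `q` is a shift: `q * w_{j+1} = w_j - p_j`. As `w_0 = P(q) = 0` and the top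
-- truncation is `1`, the integer corrections and the new digit fit into the last coefficient, and
-- induction on the length of `x` applies.
open Polynomial in
theorem exists_carryEval_eq {P : ℤ[X]} (hP : P.Monic) {q : 𝓞 K} {d : ℕ}
    (hd : P.natDegree = d + 1) (hPq : aeval q P = 0)
    (hf : HasFiniteness q (canonicalDigits q)) (x : 𝓞 K) :
    ∃ s, carryEval P q (d + 1) s = x := by
  obtain ⟨k, hk⟩ := hf.exists_mem_truncatedIntegers x
  induction k generalizing x with
  | zero =>
    obtain ⟨b, -, rfl⟩ := hk
    exact ⟨0, by simp [carryEval]⟩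
  | succ k ih =>
    rw [add_comm] at hk
    obtain ⟨u, hu, v, hv, rfl⟩ := exists_split_of_mem_truncatedIntegers hk
    obtain ⟨s, rfl⟩ := ih v hv
    obtain ⟨n, -, rfl⟩ := Finset.mem_map.1 (mem_truncatedIntegers_one.1 hu)
    have hw : truncatedEval P q (d + 1) = 1 := by rw [← hd, truncatedEval_natDegree hP]
    have key : q * carryEval P q (d + 1) s =
        ∑ j ∈ Finset.range (d + 1), (s j : 𝓞 K) * truncatedEval P q j -
          ∑ j ∈ Finset.range (d + 1), (s j : 𝓞 K) * (P.coeff j : ℤ) := by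
      rw [carryEval, Finset.mul_sum, ← Finset.sum_sub_distrib]
      refine Finset.sum_congr rfl fun j _ => ?_
      rw [truncatedEval_eq P q j]
      ring
    have hw0 : truncatedEval P q 0 = 0 := hPq
    obtain ⟨m, hm⟩ : ∃ m : ℤ, m = n - ∑ i ∈ Finset.range (d + 1), s i * P.coeff i := ⟨_, rfl⟩
    have hm' := congrArg (Int.cast : ℤ → 𝓞 K) hm
    push_cast at hm'
    refine ⟨fun j => if j = d then m else s (j + 1), ?_⟩
    rw [pow_one, key, carryEval, Finset.sum_range_succ, if_pos rfl, hw,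
      Finset.sum_congr rfl fun j hj => by rw [if_neg (Finset.mem_range.1 hj).ne],
      Finset.sum_range_succ' (fun j => (s j : 𝓞 K) * truncatedEval P q j), hw0, hm',
      Nat.castEmbedding_apply]
    ring

-- With `e s = ∑ s_j p_{j+1}`, the carry of `s` is `e s + q * ∑ s_j w_{j+2}`, while `Q = -sign(p_0)
-- * q * w_1`. Dividing `n + e s` by `Q` with quotient `k` therefore yields the output digit and a
-- new vector: `s` shifted, with `-sign(p_0) * k` in front. In the weight, the shift gains `1 / x`
-- against `Q ≤ C * x ^ (d + 1)`, and the front entries sum to at most `|e s| ≤ C * V s`, taken with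
-- weight `x ^ d`. Each contributes `C * x ^ d * V s`.
open Polynomial in
theorem exists_ncard_overflow_canonicalDigits_le {P : ℤ[X]} (hP : P.Monic) {q : 𝓞 K} {d : ℕ}
    (hd : P.natDegree = d + 1) (hPq : aeval q P = 0) (hP0 : (P.coeff 0).natAbs = absNorm q)
    {x C : ℝ} (hx : 1 ≤ x) (hC : 0 ≤ C)
    (hcoeff : ∀ j ≤ d + 1, |(P.coeff j : ℝ)| ≤ C * x ^ (d + 1 - j))
    (h : IsCNSBase q) (hf : HasFiniteness q (canonicalDigits q)) (y : 𝓞 K) :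
    ∃ A : ℝ, 0 ≤ A ∧ ∀ k, ((overflow q (canonicalDigits q) k y).ncard : ℝ) ≤
      A * (2 * C * x ^ d) ^ k := by
  have hx0 : 0 < x := by linarith
  obtain ⟨s, rfl⟩ := exists_carryEval_eq hP hd hPq hf y
  set Q := absNorm q with hQdef
  have hQ : 0 < Q := lt_of_lt_of_le two_pos (IsNumberSystem.two_le_absNorm h)
  set w := truncatedEval P q with hw
  have hw0 : q * w 1 + (P.coeff 0 : ℤ) = 0 := by
    rw [← truncatedEval_eq P q 0]
    exact hPq
  set e : (ℕ → ℤ) → ℤ := fun s => ∑ j ∈ Finset.range (d + 1), s j * P.coeff (j + 1) with he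
  set kk : (ℕ → ℤ) → ℕ → ℤ := fun s n => ((n : ℤ) + e s) / Q with hkk
  set nx : (ℕ → ℤ) → ℕ → ℕ → ℤ := fun s n j =>
    Nat.casesOn j (-(P.coeff 0).sign * kk s n) s with hnx
  have hnx0 : ∀ s n, nx s n 0 = -(P.coeff 0).sign * kk s n := fun _ _ => rfl
  have hnxs : ∀ s n j, nx s n (j + 1) = s j := fun _ _ _ => rfl
  -- Reads a digit back as a natural number, so that the division takes place in `ℤ`.
  set num : 𝓞 K → ℕ := Function.invFun (Nat.cast : ℕ → 𝓞 K) with hnum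
  have hnumc : ∀ n : ℕ, num (n : 𝓞 K) = n :=
    Function.leftInverse_invFun Nat.cast_injective
  set V : (ℕ → ℤ) → ℝ := fun s => ∑ j ∈ Finset.range (d + 1), |(s j : ℝ)| * x ^ (d - j) with hV
  have hV0 : ∀ s, 0 ≤ V s := fun s => by positivity
  refine ⟨V s, hV0 s, fun k => ncard_overflow_le_of_weight h hf (carryEval P q (d + 1))
    (fun s b => nx s (num b)) V (by positivity) hV0 ?_ ?_ ?_ k s⟩
  · intro s hs
    obtain ⟨j, hj, hne⟩ := Finset.exists_ne_zero_of_sum_ne_zero hs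
    have hsj : s j ≠ 0 := by
      intro h0
      simp [h0] at hne
    have h1 : (1 : ℝ) ≤ |(s j : ℝ)| := by exact_mod_cast Int.one_le_abs hsj
    calc (1 : ℝ) ≤ |(s j : ℝ)| * x ^ (d - j) := one_le_mul_of_one_le_of_one_le h1 (one_le_pow₀ hx)
      _ ≤ V s := Finset.single_le_sum (f := fun j => |(s j : ℝ)| * x ^ (d - j))
        (fun _ _ => by positivity) hj
  · intro s b hb
    obtain ⟨n, -, rfl⟩ := Finset.mem_map.1 hb
    refine ⟨((((n : ℤ) + e s) % Q).toNat : ℕ), ?_, ?_⟩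
    · refine Finset.mem_map.2 ⟨_, Finset.mem_range.2 ?_, rfl⟩
      have := Int.emod_lt_of_pos ((n : ℤ) + e s) (by exact_mod_cast hQ : (0 : ℤ) < Q)
      omega
    · have h1 : ((((n : ℤ) + e s) % Q).toNat : ℤ) + Q * kk s n = n + e s := by
        rw [Int.toNat_of_nonneg (Int.emod_nonneg _ (by exact_mod_cast hQ.ne'))]
        exact Int.emod_add_mul_ediv _ _
      have h2 : ((((n : ℤ) + e s) % Q).toNat : 𝓞 K) + Q * (kk s n : ℤ) = n + (e s : ℤ) := by
        exact_mod_cast congrArg (Int.cast : ℤ → 𝓞 K) h1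
      have h3 : (Q : 𝓞 K) = ((P.coeff 0).sign : ℤ) * (P.coeff 0 : ℤ) := by
        rw [← Int.cast_mul, Int.sign_mul_self, hP0, Int.cast_natCast]
      have h4 : carryEval P q (d + 1) s = (e s : ℤ) +
          q * ∑ j ∈ Finset.range d, (s j : 𝓞 K) * w (j + 1 + 1) := by
        -- The last coefficient would be shifted onto this vanishing truncation, so it can be
        -- dropped.
        have : w (d + 1 + 1) = 0 := truncatedEval_of_natDegree_lt (by omega) q
        have h5 : ∑ j ∈ Finset.range d, (s j : 𝓞 K) * w (j + 1 + 1) =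
            ∑ j ∈ Finset.range (d + 1), (s j : 𝓞 K) * w (j + 1 + 1) := by
          rw [Finset.sum_range_succ, this, mul_zero, add_zero]
        rw [h5, carryEval, Finset.mul_sum, he, Int.cast_sum, ← Finset.sum_add_distrib]
        refine Finset.sum_congr rfl fun j _ => ?_
        rw [truncatedEval_eq P q (j + 1)]
        push_cast
        ring
      have h5 : carryEval P q (d + 1) (nx s n) = ∑ j ∈ Finset.range d, (s j : 𝓞 K) * w (j + 1 + 1) -
          ((P.coeff 0).sign : ℤ) * (kk s n : ℤ) * w 1 := by
        rw [carryEval, Finset.sum_range_succ', hnx0]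
        simp only [hnxs, ← hw]
        push_cast
        ring
      simp only [Nat.castEmbedding_apply, hnumc]
      rw [h4, h5]
      linear_combination -h2 + (kk s n : 𝓞 K) * h3 + (P.coeff 0).sign * (kk s n : 𝓞 K) * hw0
  · intro s
    have hVn : ∀ n, V (nx s n) = ∑ j ∈ Finset.range d, |(s j : ℝ)| * x ^ (d - (j + 1)) +
        |(kk s n : ℝ)| * x ^ d := by
      intro n
      have hs0 : P.coeff 0 ≠ 0 := by
        intro h0
        rw [h0] at hP0
        simp at hP0
        omega
      simp only [hV]
      rw [Finset.sum_range_succ']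
      simp only [hnxs, hnx0, Nat.sub_zero, Int.cast_mul, abs_mul]
      congr 2
      rw [← Int.cast_abs, abs_neg, Int.abs_sign_of_ne_zero hs0, Int.cast_one, one_mul]
    have h1 : ∑ b ∈ canonicalDigits q, V (nx s (num b)) =
        Q * ∑ j ∈ Finset.range d, |(s j : ℝ)| * x ^ (d - (j + 1)) +
          (∑ n ∈ Finset.range Q, |(kk s n : ℝ)|) * x ^ d := by
      rw [canonicalDigits, Finset.sum_map]
      simp only [Nat.castEmbedding_apply, hnumc, hVn]
      rw [Finset.sum_add_distrib, Finset.sum_const, Finset.card_range, nsmul_eq_mul,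
        Finset.sum_mul]
    have h2 : ∑ n ∈ Finset.range Q, |(kk s n : ℝ)| ≤ C * V s := by
      have h3 : ∑ n ∈ Finset.range Q, |(kk s n : ℝ)| ≤ |(e s : ℝ)| := by
        exact_mod_cast sum_range_abs_add_ediv_le hQ (e s)
      refine h3.trans ?_
      simp only [he, hV, Int.cast_sum, Finset.mul_sum]
      refine (Finset.abs_sum_le_sum_abs _ _).trans (Finset.sum_le_sum fun j hj => ?_)
      have := hcoeff (j + 1) (by have := Finset.mem_range.1 hj; omega)
      rw [Nat.add_sub_add_right] at this
      rw [Int.cast_mul, abs_mul]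
      calc _ ≤ |(s j : ℝ)| * (C * x ^ (d - j)) := mul_le_mul_of_nonneg_left this (abs_nonneg _)
        _ = _ := by ring
    have h3 : (Q : ℝ) ≤ C * x ^ (d + 1) := by
      have := hcoeff 0 (by omega)
      rw [← Int.cast_abs, Int.abs_eq_natAbs, hP0] at this
      simpa using this
    have h4 : x * ∑ j ∈ Finset.range d, |(s j : ℝ)| * x ^ (d - (j + 1)) ≤ V s := by
      simp only [hV]
      rw [Finset.sum_range_succ, Finset.mul_sum]
      refine le_add_of_le_of_nonneg (le_of_eq (Finset.sum_congr rfl fun j hj => ?_)) (by positivity)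
      have := Finset.mem_range.1 hj
      rw [show d - j = d - (j + 1) + 1 by omega, pow_succ]
      ring
    rw [h1]
    set Y := ∑ j ∈ Finset.range d, |(s j : ℝ)| * x ^ (d - (j + 1)) with hY
    have hY0 : 0 ≤ Y := by positivity
    calc Q * Y + _ ≤ C * x ^ (d + 1) * Y + C * V s * x ^ d := by gcongr
      _ = C * x ^ d * (x * Y) + C * V s * x ^ d := by ring
      _ ≤ C * x ^ d * V s + C * V s * x ^ d := by gcongr
      _ = _ := by ring


/-! ### The overflow bound, uniform over translates -/

open Polynomial in
theorem eval_abs_le_of_natDegree_le {p : ℤ[X]} {n : ℕ} (hn : p.natDegree ≤ n) {m : ℕ}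
    (hm : 1 ≤ m) :
    |((p.eval (m : ℤ) : ℤ) : ℝ)| ≤ (∑ i ∈ Finset.range (n + 1), |(p.coeff i : ℝ)|) * (m : ℝ) ^ n := by
  have hm' : (1 : ℝ) ≤ m := by exact_mod_cast hm
  rw [eval_eq_sum_range' (Nat.lt_succ_of_le hn), Finset.sum_mul]
  push_cast
  refine (Finset.abs_sum_le_sum_abs _ _).trans (Finset.sum_le_sum fun i hi => ?_)
  rw [abs_mul, abs_of_nonneg (by positivity : (0 : ℝ) ≤ (m : ℝ) ^ i)]
  gcongr
  exact Nat.lt_succ_iff.1 (Finset.mem_range.1 hi)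

/-- For the translates `q = q₀ - m`, the number of overflows of length `k` is
`O((C m ^ (d - 1)) ^ k)` with `C` independent of `m`. -/
theorem exists_ncard_overflow_translate_le (q₀ : 𝓞 K) :
    ∃ C : ℝ, 1 ≤ C ∧ ∀ m : ℕ, 1 ≤ m → ∀ q : 𝓞 K, q = -(m : 𝓞 K) + q₀ →
      IsCNSBase q → HasFiniteness q (canonicalDigits q) → ∀ y : 𝓞 K,
        ∃ A : ℝ, 0 ≤ A ∧ ∀ k, ((overflow q (canonicalDigits q) k y).ncard : ℝ) ≤
          A * (C * (m : ℝ) ^ (Module.finrank ℚ K - 1)) ^ k := by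
  -- The characteristic polynomial has full degree and constant term `±` the norm, whether or not
  -- `q₀` generates `K`.
  set P₀ := (Algebra.lmul ℤ (𝓞 K) q₀).charpoly with hP₀
  have hd1 : 0 < Module.finrank ℚ K := Module.finrank_pos
  obtain ⟨d, hd⟩ : ∃ d, Module.finrank ℚ K = d + 1 := ⟨_, (Nat.succ_pred_eq_of_pos hd1).symm⟩
  have hdeg : P₀.natDegree = d + 1 := by
    rw [hP₀, LinearMap.charpoly_natDegree, NumberField.RingOfIntegers.rank, hd]
  -- The `j`-th coefficient of `P₀(X + m)` is the `j`-th Hasse derivative at `m`, a polynomial in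
  -- `m` of degree at most `d + 1 - j` with coefficients depending on `P₀` alone.
  set C : ℝ := 1 + ∑ j ∈ Finset.range (d + 2), ∑ i ∈ Finset.range (d + 1 - j + 1),
    |((Polynomial.hasseDeriv j P₀).coeff i : ℝ)| with hC
  have hC1 : 1 ≤ C := le_add_of_nonneg_right (by positivity)
  refine ⟨2 * C, by linarith, fun m hm q hq hb hf y => ?_⟩
  set P := Polynomial.taylor (m : ℤ) P₀ with hP
  have hchar : (Algebra.lmul ℤ (𝓞 K) q).charpoly = P := by
    rw [hP, Polynomial.taylor_apply, hP₀, ← LinearMap.charpoly_sub_smul]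
    congr 1
    ext z
    simp [hq]
    ring
  have hmonic : P.Monic := hchar ▸ LinearMap.charpoly_monic _
  have hPq : Polynomial.aeval q P = 0 := by
    have h1 := LinearMap.aeval_self_charpoly (Algebra.lmul ℤ (𝓞 K) q)
    rw [hchar, Polynomial.aeval_algHom_apply] at h1
    simpa using congrArg (fun f => f 1) h1
  have hP0 : (P.coeff 0).natAbs = absNorm q := by
    rw [absNorm, Algebra.norm_apply, LinearMap.det_eq_sign_charpoly_coeff, Int.natAbs_mul,
      Int.natAbs_pow]
    simp [← hchar]
  have := exists_ncard_overflow_canonicalDigits_le hmonic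
    (by rw [hP, Polynomial.natDegree_taylor, hdeg]) hPq hP0
    (x := m) (C := C) (by exact_mod_cast hm) (by linarith) (fun j hj => ?_) hb hf y
  · rwa [hd, Nat.add_sub_cancel]
  · rw [hP, Polynomial.taylor_coeff]
    refine (eval_abs_le_of_natDegree_le
      ((Polynomial.natDegree_hasseDeriv_le P₀ j).trans (by rw [hdeg])) hm).trans ?_
    gcongr
    refine le_trans ?_ (le_add_of_nonneg_left zero_le_one)
    exact Finset.single_le_sum (f := fun j => ∑ i ∈ Finset.range (d + 1 - j + 1),
      |((Polynomial.hasseDeriv j P₀).coeff i : ℝ)|) (fun _ _ => by positivity)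
      (Finset.mem_range.2 (by omega))

/-! ### From overflows to carry constants -/

/-- The integers of length `k` which leave this set by adding some integer with all conjugates
bounded by `R`. -/
def boundaryIntegers (q : 𝓞 K) (D : Finset (𝓞 K)) (R : ℝ) (k : ℕ) : Set (𝓞 K) :=
  {t | ∃ s : 𝓞 K, (∀ φ : K →+* ℂ, ‖φ (s : K)‖ ≤ R) ∧ t ∈ overflow q D k s}

theorem boundaryIntegers_finite (q : 𝓞 K) {D : Finset (𝓞 K)} (h0 : (0 : 𝓞 K) ∈ D) (R : ℝ)
    (k : ℕ) : (boundaryIntegers q D R k).Finite :=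
  (truncatedIntegers_finite q h0 k).1.subset fun _ ⟨_, _, ht⟩ => ht.1

theorem exists_ncard_boundaryIntegers_le {q : 𝓞 K} {D : Finset (𝓞 K)} (h0 : (0 : 𝓞 K) ∈ D)
    {lam : ℝ} (hlam : 0 ≤ lam) {R : ℝ}
    (h : ∀ s : 𝓞 K, (∀ φ : K →+* ℂ, ‖φ (s : K)‖ ≤ R) →
      ∃ A : ℝ, 0 ≤ A ∧ ∀ k, ((overflow q D k s).ncard : ℝ) ≤ A * lam ^ k) :
    ∃ A : ℝ, 1 ≤ A ∧ ∀ k, ((boundaryIntegers q D R k).ncard : ℝ) ≤ A * lam ^ k := by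
  choose! A hA0 hA using h
  have hS := finite_setOf_norm_le (K := K) R
  refine ⟨1 + ∑ s ∈ hS.toFinset, A s, le_add_of_nonneg_right
    (Finset.sum_nonneg fun s hs => hA0 s (hS.mem_toFinset.1 hs)), fun k => ?_⟩
  have hsub : boundaryIntegers q D R k ⊆ ⋃ s ∈ hS.toFinset, overflow q D k s := by
    rintro t ⟨s, hs, ht⟩
    exact Set.mem_biUnion (hS.mem_toFinset.2 hs) ht
  have hfin : (⋃ s ∈ hS.toFinset, overflow q D k s).Finite :=
    (Finset.finite_toSet _).biUnion fun s _ => overflow_finite q h0 k s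
  have h1 : (boundaryIntegers q D R k).ncard ≤ ∑ s ∈ hS.toFinset, (overflow q D k s).ncard :=
    (Set.ncard_le_ncard hsub hfin).trans (Finset.set_ncard_biUnion_le _ _)
  calc ((boundaryIntegers q D R k).ncard : ℝ)
      ≤ ∑ s ∈ hS.toFinset, ((overflow q D k s).ncard : ℝ) := by exact_mod_cast h1
    _ ≤ ∑ s ∈ hS.toFinset, A s * lam ^ k :=
      Finset.sum_le_sum fun s hs => hA s (hS.mem_toFinset.1 hs) k
    _ = (∑ s ∈ hS.toFinset, A s) * lam ^ k := (Finset.sum_mul _ _ _).symm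
    _ ≤ _ := mul_le_mul_of_nonneg_right (by linarith) (by positivity)

/-- Cut `m` into blocks of lengths `ν - ρ`, `ρ`, `μ - ν`. The carry out of the first block is a
combination of three integers of length `ν - ρ`, divided by `q ^ (ν - ρ)`, hence bounded by `3 * c`.
If the middle block absorbs it, the digits from `ν` on do not change. -/
theorem exists_carry_subset {q : 𝓞 K} {D : Finset (𝓞 K)} (h : IsNumberSystem q D)
    (hf : HasFiniteness q D) :
    ∃ R : ℝ, ∀ ρ ν μ : ℕ, ρ ≤ ν → ν ≤ μ →
      {m ∈ truncatedIntegers q D μ | ∃ n ∈ truncatedIntegers q D (ν - ρ),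
        digitTail q D ν (m + n) ≠ digitTail q D ν m} ⊆
      (fun p : (𝓞 K × 𝓞 K) × 𝓞 K => p.1.1 + q ^ (ν - ρ) * p.1.2 + q ^ ν * p.2) ''
        ((truncatedIntegers q D (ν - ρ) ×ˢ boundaryIntegers q D R ρ) ×ˢ
          truncatedIntegers q D (μ - ν)) := by
  obtain ⟨c, hc, hcφ⟩ := exists_norm_le_of_mem_truncatedIntegers h
  refine ⟨3 * c, fun ρ ν μ hρν hνμ => ?_⟩
  set κ := ν - ρ with hκ
  have hν : κ + ρ = ν := by omega
  rintro m ⟨hm, n, hn, hne⟩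
  rw [show μ = ν + (μ - ν) by omega] at hm
  obtain ⟨u, hu, m1, hm1, rfl⟩ := exists_split_of_mem_truncatedIntegers hm
  rw [← hν] at hu
  obtain ⟨m0, hm0, t, ht, rfl⟩ := exists_split_of_mem_truncatedIntegers hu
  obtain ⟨r, hr, e⟩ := hf.exists_eq_add_digitTail κ (m0 + n)
  set s := digitTail q D κ (m0 + n)
  refine ⟨((m0, t), m1), ⟨⟨hm0, s, fun φ => ?_, ht, fun hts => hne ?_⟩, hm1⟩, rfl⟩
  · have hx : 0 < ‖φ (q : K)‖ ^ κ := pow_pos (one_pos.trans (h.one_lt_norm_conj φ)) _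
    refine le_of_mul_le_mul_left ?_ hx
    have e' : φ (q : K) ^ κ * φ (s : K) = φ (m0 : K) + φ (n : K) - φ (r : K) := by
      have := congrArg (fun x : 𝓞 K => φ (x : K)) e
      simp only [map_add, map_mul, map_pow] at this
      rw [this]; ring
    calc _ = ‖φ (q : K) ^ κ * φ (s : K)‖ := by rw [norm_mul, norm_pow]
      _ ≤ ‖φ (m0 : K)‖ + ‖φ (n : K)‖ + ‖φ (r : K)‖ := by
        rw [e']
        exact (norm_sub_le _ _).trans (add_le_add_left (norm_add_le _ _) _)
      _ ≤ c * ‖φ (q : K)‖ ^ κ + c * ‖φ (q : K)‖ ^ κ + c * ‖φ (q : K)‖ ^ κ :=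
        add_le_add (add_le_add (hcφ φ κ m0 hm0) (hcφ φ κ n hn)) (hcφ φ κ r hr)
      _ = _ := by ring
  · rw [← hν]
    have hw := add_mem_truncatedIntegers hr hts
    rw [h.digitTail_add_pow_mul hf hu, show m0 + q ^ κ * t + q ^ (κ + ρ) * m1 + n =
      r + q ^ κ * (t + s) + q ^ (κ + ρ) * m1 by linear_combination e,
      h.digitTail_add_pow_mul hf hw]

/-- The outer blocks are free, and the middle one costs `lam ^ ρ ≤ Q ^ ((1 - η) * ρ)`. `R` is fixed
first because the `lam` of `exists_ncard_overflow_le` depends on it. -/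
theorem exists_isCarryConstant_of_ncard_overflow_le {q : 𝓞 K} {D : Finset (𝓞 K)}
    (h : IsNumberSystem q D) (hf : HasFiniteness q D) (hD : D.card = absNorm q) :
    ∃ R : ℝ, ∀ lam η : ℝ, 0 ≤ lam → 0 < η → η ≤ 1 → lam ≤ (absNorm q : ℝ) ^ (1 - η) →
      (∀ s : 𝓞 K, (∀ φ : K →+* ℂ, ‖φ (s : K)‖ ≤ R) →
        ∃ A : ℝ, 0 ≤ A ∧ ∀ k, ((overflow q D k s).ncard : ℝ) ≤ A * lam ^ k) →
      IsCarryConstant q D η := by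
  obtain ⟨R, hR⟩ := exists_carry_subset h hf
  refine ⟨R, fun lam η hlam hη0 hη1 hle hov => ?_⟩
  obtain ⟨A, hA1, hA⟩ := exists_ncard_boundaryIntegers_le h.zero_mem hlam hov
  refine ⟨hη0, hη1, A, fun ρ ν μ hρν hνμ => ?_⟩
  have hN := truncatedIntegers_finite q h.zero_mem
  have hfin := ((hN (ν - ρ)).1.prod (boundaryIntegers_finite q h.zero_mem R ρ)).prod (hN (μ - ν)).1
  have hsub := hR ρ ν μ hρν hνμ
  refine ⟨(hfin.image _).subset hsub, ?_⟩
  have h1 := (Set.ncard_le_ncard hsub (hfin.image _)).trans (Set.ncard_image_le hfin)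
  rw [Set.ncard_prod, Set.ncard_prod] at h1
  have h2 := h1.trans (Nat.mul_le_mul (Nat.mul_le_mul_right _ (hN (ν - ρ)).2) (hN (μ - ν)).2)
  set Q := absNorm q with hQ
  rw [hD] at h2
  have hQ0 : (0 : ℝ) < Q := by
    have := h.two_le_absNorm
    rw [← hQ] at this
    exact_mod_cast (by omega : 0 < Q)
  calc _ ≤ (Q : ℝ) ^ (ν - ρ) * (boundaryIntegers q D R ρ).ncard * (Q : ℝ) ^ (μ - ν) := by
        exact_mod_cast h2
    _ ≤ (Q : ℝ) ^ (ν - ρ) * (A * lam ^ ρ) * (Q : ℝ) ^ (μ - ν) := by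
        gcongr
        exact hA ρ
    _ ≤ (Q : ℝ) ^ (ν - ρ) * (A * ((Q : ℝ) ^ (1 - η)) ^ ρ) * (Q : ℝ) ^ (μ - ν) := by gcongr
    _ = A * (Q : ℝ) ^ ((μ : ℝ) - η * (ρ : ℝ)) := by
        rw [← Real.rpow_natCast, ← Real.rpow_natCast ((Q : ℝ) ^ (1 - η)),
          ← Real.rpow_natCast (Q : ℝ) (μ - ν), ← Real.rpow_mul hQ0.le, Nat.cast_sub hρν,
          Nat.cast_sub hνμ, mul_left_comm, mul_assoc, ← Real.rpow_add hQ0, ← Real.rpow_add hQ0]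
        ring_nf

/-- Every number system with the finiteness property has a carry constant. -/
theorem exists_isCarryConstant {q : 𝓞 K} {D : Finset (𝓞 K)}
    (h : IsNumberSystem q D) (hf : HasFiniteness q D) (hD : D.card = absNorm q) :
    ∃ η : ℝ, IsCarryConstant q D η := by
  obtain ⟨R, hR⟩ := exists_isCarryConstant_of_ncard_overflow_le h hf hD
  have hQ := h.two_le_absNorm
  have hQ1 : (1 : ℝ) < absNorm q := by exact_mod_cast hQ
  obtain ⟨lam, A, hlam1, hlamD, hA, hle⟩ := exists_ncard_overflow_le h hf (hD ▸ hQ) R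
  rw [hD] at hlamD
  have hlam0 : 0 < lam := by linarith
  refine ⟨1 - Real.logb (absNorm q) lam, hR lam _ hlam0.le ?_ ?_ ?_
    fun s hs => ⟨A, hA, fun k => hle k s hs⟩⟩
  · rw [sub_pos, Real.logb_lt_iff_lt_rpow hQ1 hlam0, Real.rpow_one]
    exact hlamD
  · exact sub_le_self _ (Real.logb_nonneg hQ1 hlam1)
  · rw [sub_sub_cancel, Real.rpow_logb (by linarith) hQ1.ne' hlam0]

/-! ### Carry constants of the translates -/

theorem exists_norm_le (q₀ : 𝓞 K) : ∃ H : ℝ, 1 ≤ H ∧ ∀ φ : K →+* ℂ, ‖φ (q₀ : K)‖ ≤ H :=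
  ⟨1 + ∑ φ : K →+* ℂ, ‖φ (q₀ : K)‖, le_add_of_nonneg_right (by positivity), fun φ =>
    (Finset.single_le_sum (f := fun φ : K →+* ℂ => ‖φ (q₀ : K)‖)
      (fun _ _ => norm_nonneg _) (Finset.mem_univ φ)).trans (le_add_of_nonneg_left zero_le_one)⟩

theorem half_le_norm_translate {q₀ : 𝓞 K} {H : ℝ} (hH : ∀ φ : K →+* ℂ, ‖φ (q₀ : K)‖ ≤ H) {m : ℕ}
    (hm : 2 * H ≤ m) (φ : K →+* ℂ) :
    (m : ℝ) / 2 ≤ ‖φ ((-(m : 𝓞 K) + q₀ : 𝓞 K) : K)‖ := by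
  have h1 : φ ((-(m : 𝓞 K) + q₀ : 𝓞 K) : K) = φ (q₀ : K) - m := by simp; ring
  have h2 : ‖(m : ℂ)‖ = m := by simp
  have h3 := norm_sub_norm_le (m : ℂ) (φ (q₀ : K))
  rw [h1, norm_sub_rev]
  linarith [hH φ]

theorem half_log_le_log_half {m : ℕ} (hm : 4 ≤ m) :
    Real.log m / 2 ≤ Real.log ((m : ℝ) / 2) := by
  have hm' : (4 : ℝ) ≤ m := by exact_mod_cast hm
  rw [Real.log_div (by linarith) two_ne_zero]
  have : Real.log 4 ≤ Real.log m := Real.log_le_log (by norm_num) hm'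
  rw [show (4 : ℝ) = 2 ^ 2 by norm_num, Real.log_pow] at this
  push_cast at this
  linarith

theorem exists_isCarryConstant_translate (q₀ : 𝓞 K) :
    ∃ C : ℝ, ∀ m : ℕ, 2 ≤ m → ∀ q : 𝓞 K, q = -(m : 𝓞 K) + q₀ →
      IsCNSBase q → HasFiniteness q (canonicalDigits q) →
        ∃ η : ℝ, IsCarryConstant q (canonicalDigits q) η ∧
          1 / (Module.finrank ℚ K : ℝ) - C / Real.log m ≤ η := by
  obtain ⟨B, hB1, hB⟩ := exists_ncard_overflow_translate_le q₀
  obtain ⟨H, hH1, hH⟩ := exists_norm_le q₀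
  have hl2 : 0 < Real.log 2 := Real.log_pos one_lt_two
  have hlB : 0 ≤ Real.log B := Real.log_nonneg hB1
  have hlH : 0 ≤ Real.log (2 * H) := Real.log_nonneg (by linarith)
  have hl4 : 0 ≤ Real.log 4 := Real.log_nonneg (by norm_num)
  -- The first two terms force `m ≥ 4` and `m ≥ 2 * H` when the bound is positive. The rest is twice
  -- `log 2 + log B`, as `log m - log 2` is estimated by half of `log m`.
  set C := Real.log 4 + Real.log (2 * H) + 2 * Real.log 2 + 2 * Real.log B with hC
  refine ⟨C, fun m hm q hq hb hf => ?_⟩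
  have hD := card_canonicalDigits q
  obtain ⟨R, hR⟩ := exists_isCarryConstant_of_ncard_overflow_le hb hf hD
  have hm0 : (0 : ℝ) < m := by exact_mod_cast (by omega : 0 < m)
  have hL : 0 < Real.log m := Real.log_pos (by exact_mod_cast (by omega : 1 < m))
  have hd1 : 0 < Module.finrank ℚ K := Module.finrank_pos
  obtain ⟨e, hd⟩ : ∃ e, Module.finrank ℚ K = e + 1 := ⟨_, (Nat.succ_pred_eq_of_pos hd1).symm⟩
  set η : ℝ := 1 / (Module.finrank ℚ K : ℝ) - C / Real.log m with hη
  -- A nonpositive bound is met by any carry constant. Otherwise `C / log m < 1 / d ≤ 1`, so `m` is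
  -- above the thresholds built into `C`.
  rcases le_or_gt η 0 with h0 | h0
  · obtain ⟨η', hη'⟩ := exists_isCarryConstant hb hf hD
    exact ⟨η', hη', h0.trans hη'.1.le⟩
  have hd0 : (0 : ℝ) < Module.finrank ℚ K := by exact_mod_cast hd1
  have hinv : 1 / (Module.finrank ℚ K : ℝ) ≤ 1 := by
    rw [div_le_one hd0]; exact_mod_cast hd1
  have hη1 : η ≤ 1 := (sub_le_self _ (by positivity)).trans hinv
  have hCL : C ≤ Real.log m := by
    have : C / Real.log m ≤ 1 := by linarith
    exact (div_le_one hL).1 this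
  have hm4 : 4 ≤ m := by
    have : (4 : ℝ) ≤ m := (Real.log_le_log_iff (by norm_num) hm0).1 (by linarith)
    exact_mod_cast this
  have hmH : 2 * H ≤ m := (Real.log_le_log_iff (by linarith) hm0).1 (by linarith)
  have hQ : ((m : ℝ) / 2) ^ (e + 1) ≤ absNorm q := by
    rw [absNorm_eq_prod_norm, ← hd, ← NumberField.Embeddings.card K ℂ, ← Finset.card_univ,
      ← Finset.prod_const]
    exact Finset.prod_le_prod (fun _ _ => by positivity)
      fun φ _ => hq ▸ half_le_norm_translate hH hmH φ
  refine ⟨η, hR (B * (m : ℝ) ^ e) η (by positivity) h0 hη1 ?_ fun s _ => ?_, le_rfl⟩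
  · have hQ0 : (0 : ℝ) < absNorm q := lt_of_lt_of_le (by positivity) hQ
    have hlQ : (e + 1) * (Real.log m - Real.log 2) ≤ Real.log (absNorm q) := by
      have := Real.log_le_log (by positivity) hQ
      rw [Real.log_pow, Real.log_div hm0.ne' two_ne_zero] at this
      push_cast at this
      exact this
    have hlm : Real.log m / 2 ≤ Real.log m - Real.log 2 := by
      rw [← Real.log_div hm0.ne' two_ne_zero]
      exact half_log_le_log_half hm4
    rw [← Real.log_le_log_iff (by positivity) (by positivity), Real.log_rpow hQ0,
      Real.log_mul (by positivity) (by positivity), Real.log_pow]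
    refine le_trans ?_ (mul_le_mul_of_nonneg_left hlQ (by linarith))
    have he : (1 - η) * ((e + 1) * (Real.log m - Real.log 2)) =
        e * (Real.log m - Real.log 2) +
          (e + 1) * (C * ((Real.log m - Real.log 2) / Real.log m)) := by
      rw [hη, hd]
      push_cast
      field_simp
      ring
    have hhalf : 1 / 2 ≤ (Real.log m - Real.log 2) / Real.log m := by
      rw [le_div_iff₀ hL]; linarith
    have hC' : Real.log 2 + Real.log B ≤ C * ((Real.log m - Real.log 2) / Real.log m) := by
      calc _ ≤ C * (1 / 2) := by rw [hC]; linarith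
        _ ≤ _ := mul_le_mul_of_nonneg_left hhalf (by positivity)
    have he0 : (0 : ℝ) ≤ e := Nat.cast_nonneg _
    have := mul_le_mul_of_nonneg_left hC' (by linarith : (0 : ℝ) ≤ (e : ℝ) + 1)
    rw [he]
    nlinarith [mul_nonneg he0 hlB]
  · have := hB m (by omega) q hq hb hf s
    rwa [hd, Nat.add_sub_cancel] at this

/-! ### Coordinates versus conjugates -/

variable {d : ℕ}

theorem coordinates_sub (ω : Module.Basis (Fin d) ℤ (𝓞 K)) (x y : K) :
    coordinates ω (x - y) = coordinates ω x - coordinates ω y := by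
  ext i
  simp [coordinates]

theorem norm_toLp_le_sum (v : Fin d → ℝ) :
    ‖(WithLp.toLp 2 v : EuclideanSpace ℝ (Fin d))‖ ≤ ∑ i, |v i| := by
  refine abs_le_of_sq_le_sq' ?_ (by positivity) |>.2
  rw [EuclideanSpace.norm_sq_eq]
  exact Finset.sum_sq_le_sq_sum_of_nonneg fun i _ => norm_nonneg _

/-- Coordinates are traces against the dual basis of the trace form, hence fixed linear combinations
of the conjugates. -/
theorem exists_norm_coordinates_le (ω : Module.Basis (Fin d) ℤ (𝓞 K)) :
    ∃ c : ℝ, 0 < c ∧ ∀ (x : K) (M : ℝ), (∀ φ : K →+* ℂ, ‖φ x‖ ≤ M) → ‖coordinates ω x‖ ≤ c * M := by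
  set β := ω.localizationLocalization ℚ (nonZeroDivisors ℤ) K with hβ
  set β' := (Algebra.traceForm ℚ K).dualBasis (traceForm_nondegenerate ℚ K) β with hβ'
  have hββ : (Algebra.traceForm ℚ K).dualBasis (traceForm_nondegenerate ℚ K) β' = β :=
    LinearMap.BilinForm.dualBasis_dualBasis _ (Algebra.traceForm_isSymm ℚ) β
  have hrepr : ∀ (x : K) i, ((β.repr x i : ℚ) : ℂ) = ∑ φ : K →+* ℂ, φ x * φ (β' i) := by
    intro x i
    have h1 : β.repr x i = Algebra.trace ℚ K (x * β' i) := by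
      conv_lhs => rw [← hββ]
      rw [LinearMap.BilinForm.dualBasis_repr_apply, Algebra.traceForm_apply]
    have h2 := trace_eq_sum_embeddings (K := ℚ) (L := K) ℂ (x := x * β' i)
    rw [← Equiv.sum_comp (RingHom.equivRatAlgHom (R := K) (S := ℂ)).symm, h1]
    simpa using h2
  refine ⟨1 + ∑ i, ∑ φ : K →+* ℂ, ‖φ (β' i)‖, by positivity, fun x M hM => ?_⟩
  have hM0 : 0 ≤ M := by
    obtain ⟨φ⟩ : Nonempty (K →+* ℂ) := inferInstance
    exact (norm_nonneg _).trans (hM φ)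
  have h3 : ∀ i, |((β.repr x i : ℚ) : ℝ)| ≤ ∑ φ : K →+* ℂ, ‖φ (β' i)‖ * M := by
    intro i
    have h4 : ‖((β.repr x i : ℚ) : ℂ)‖ = |((β.repr x i : ℚ) : ℝ)| := by
      rw [← Complex.ofReal_ratCast, Complex.norm_real, Real.norm_eq_abs]
    rw [← h4, hrepr]
    refine (norm_sum_le _ _).trans (Finset.sum_le_sum fun φ _ => ?_)
    rw [norm_mul, mul_comm]
    exact mul_le_mul_of_nonneg_left (hM φ) (norm_nonneg _)
  calc ‖coordinates ω x‖ ≤ ∑ i, |((β.repr x i : ℚ) : ℝ)| := norm_toLp_le_sum _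
    _ ≤ ∑ i, ∑ φ : K →+* ℂ, ‖φ (β' i)‖ * M := Finset.sum_le_sum fun i _ => h3 i
    _ = (∑ i, ∑ φ : K →+* ℂ, ‖φ (β' i)‖) * M := by
      rw [Finset.sum_mul]
      exact Finset.sum_congr rfl fun i _ => (Finset.sum_mul _ _ _).symm
    _ ≤ _ := mul_le_mul_of_nonneg_right (by linarith) hM0

theorem exists_norm_embedding_le (ω : Module.Basis (Fin d) ℤ (𝓞 K)) :
    ∃ c : ℝ, 0 < c ∧ ∀ (x : K) (φ : K →+* ℂ), ‖φ x‖ ≤ c * ‖coordinates ω x‖ := by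
  set β := ω.localizationLocalization ℚ (nonZeroDivisors ℤ) K with hβ
  refine ⟨1 + ∑ φ : K →+* ℂ, ∑ i, ‖φ (β i)‖, by positivity, fun x φ => ?_⟩
  have h1 : φ x = ∑ i, ((β.repr x i : ℚ) : ℂ) * φ (β i) := by
    conv_lhs => rw [← β.sum_repr x]
    simp [Algebra.smul_def]
  have h2 : ∀ i, ‖((β.repr x i : ℚ) : ℂ)‖ ≤ ‖coordinates ω x‖ := by
    intro i
    rw [← Complex.ofReal_ratCast, Complex.norm_real]
    exact PiLp.norm_apply_le (coordinates ω x) i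
  calc ‖φ x‖ ≤ ∑ i, ‖coordinates ω x‖ * ‖φ (β i)‖ := by
        rw [h1]
        refine (norm_sum_le _ _).trans (Finset.sum_le_sum fun i _ => ?_)
        rw [norm_mul]
        exact mul_le_mul_of_nonneg_right (h2 i) (norm_nonneg _)
    _ = (∑ i, ‖φ (β i)‖) * ‖coordinates ω x‖ := by rw [← Finset.mul_sum, mul_comm]
    _ ≤ _ := by
      refine mul_le_mul_of_nonneg_right ?_ (norm_nonneg _)
      have := Finset.single_le_sum (f := fun φ : K →+* ℂ => ∑ i, ‖φ (β i)‖)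
        (fun _ _ => by positivity) (Finset.mem_univ φ)
      linarith

theorem denseRange_coordinates (ω : Module.Basis (Fin d) ℤ (𝓞 K)) :
    DenseRange (coordinates ω) := by
  have h1 : DenseRange fun u : Fin d → ℚ =>
      (WithLp.toLp 2 fun i => ((u i : ℚ) : ℝ) : EuclideanSpace ℝ (Fin d)) :=
    DenseRange.comp (g := fun v : Fin d → ℝ => (WithLp.toLp 2 v : EuclideanSpace ℝ (Fin d)))
      (f := Pi.map fun _ => (Rat.cast : ℚ → ℝ))
      (WithLp.toLp_surjective 2).denseRange (DenseRange.piMap fun _ => Rat.denseRange_cast)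
      (PiLp.continuous_toLp 2 _)
  refine h1.mono ?_
  rintro _ ⟨u, rfl⟩
  set β := ω.localizationLocalization ℚ (nonZeroDivisors ℤ) K with hβ
  refine ⟨β.equivFun.symm u, ?_⟩
  ext i
  have : β.repr (β.equivFun.symm u) i = u i := by
    rw [← Module.Basis.equivFun_apply, LinearEquiv.apply_symm_apply]
  exact congrArg (Rat.cast : ℚ → ℝ) this

theorem exists_near_integer (ω : Module.Basis (Fin d) ℤ (𝓞 K)) :
    ∃ G : ℝ, 0 ≤ G ∧ ∀ x : K, ∃ a : 𝓞 K, ∀ φ : K →+* ℂ, ‖φ (x - a)‖ ≤ G := by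
  obtain ⟨c, hc, hcφ⟩ := exists_norm_embedding_le ω
  set β := ω.localizationLocalization ℚ (nonZeroDivisors ℤ) K with hβ
  refine ⟨c * d, by positivity, fun x => ⟨∑ i, ⌊β.repr x i⌋ • ω i, fun φ => ?_⟩⟩
  refine (hcφ _ φ).trans (mul_le_mul_of_nonneg_left ?_ hc.le)
  have h1 : ∀ i, β.repr (x - ((∑ i, ⌊β.repr x i⌋ • ω i : 𝓞 K) : K)) i = Int.fract (β.repr x i) := by
    intro i
    have h2 : β.repr ((∑ i, ⌊β.repr x i⌋ • ω i : 𝓞 K) : K) i = ⌊β.repr x i⌋ := by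
      have := ω.localizationLocalization_repr_algebraMap ℚ (nonZeroDivisors ℤ) K
        (∑ i, ⌊β.repr x i⌋ • ω i) i
      rw [Module.Basis.repr_sum_self] at this
      exact this
    rw [map_sub, Finsupp.sub_apply, h2, Int.self_sub_floor]
  calc _ ≤ ∑ i, |((β.repr (x - ((∑ i, ⌊β.repr x i⌋ • ω i : 𝓞 K) : K)) i : ℚ) : ℝ)| :=
        norm_toLp_le_sum _
    _ ≤ ∑ i : Fin d, (1 : ℝ) := by
      refine Finset.sum_le_sum fun i _ => ?_
      rw [h1]
      have h3 := Int.fract_nonneg (β.repr x i)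
      have h4 := (Int.fract_lt_one (β.repr x i)).le
      rw [← Rat.cast_abs, abs_of_nonneg h3]
      exact_mod_cast h4
    _ = d := by simp

theorem ne_zero_coe {q : 𝓞 K} {D : Finset (𝓞 K)} (h : IsNumberSystem q D) : (q : K) ≠ 0 := by
  simpa using h.ne_zero

/-- The elements `a / q ^ N` with `a` integral are dense, and `N` may be chosen large. -/
theorem exists_dist_coordinates_lt {q : 𝓞 K} {D : Finset (𝓞 K)} (h : IsNumberSystem q D)
    (ω : Module.Basis (Fin d) ℤ (𝓞 K)) (v : EuclideanSpace ℝ (Fin d)) {ε : ℝ} (hε : 0 < ε)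
    (N₀ : ℕ) :
    ∃ (a : 𝓞 K) (N : ℕ), N₀ ≤ N ∧ dist v (coordinates ω ((a : K) * ((q : K) ^ N)⁻¹)) < ε := by
  obtain ⟨x, hx⟩ := (denseRange_coordinates ω).exists_dist_lt v (half_pos hε)
  obtain ⟨G, hG0, hG⟩ := exists_near_integer ω
  obtain ⟨c, hc, hcx⟩ := exists_norm_coordinates_le ω
  obtain ⟨r, hr, hrφ⟩ := exists_one_lt_le_norm h
  have hlim : Filter.Tendsto (fun N : ℕ => c * (G * (r⁻¹) ^ N)) Filter.atTop (𝓝 (c * (G * 0))) :=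
    ((tendsto_pow_atTop_nhds_zero_of_lt_one (by positivity) (inv_lt_one_of_one_lt₀ hr)).const_mul
      G).const_mul c
  rw [mul_zero, mul_zero] at hlim
  obtain ⟨N, hN, hN₀⟩ := ((hlim.eventually_lt_const (half_pos hε)).and
    (Filter.eventually_ge_atTop N₀)).exists
  obtain ⟨a, ha⟩ := hG (x * (q : K) ^ N)
  have hq := ne_zero_coe h
  refine ⟨a, N, hN₀, ?_⟩
  refine (dist_triangle _ (coordinates ω x) _).trans_lt ?_
  suffices dist (coordinates ω x) (coordinates ω ((a : K) * ((q : K) ^ N)⁻¹)) < ε / 2 by linarith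
  rw [dist_eq_norm, ← coordinates_sub]
  refine (hcx _ (G * (r⁻¹) ^ N) fun φ => ?_).trans_lt hN
  have e : x - (a : K) * ((q : K) ^ N)⁻¹ = (x * (q : K) ^ N - a) * ((q : K) ^ N)⁻¹ := by
    field_simp
  rw [e, map_mul, norm_mul, map_inv₀, map_pow, norm_inv, norm_pow, inv_pow]
  have : 0 < r := by linarith
  gcongr
  exacts [ha φ, hrφ φ]

/-! ### The boundary of the tile -/

/-- Clearing the denominator `q ^ r` reverses the order of the digits. -/
theorem mem_fundamentalTile_iff {q : 𝓞 K} {D : Finset (𝓞 K)} (h : IsNumberSystem q D) {x : K} :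
    x ∈ fundamentalTile q D ↔
      ∃ r : ℕ, 1 ≤ r ∧ ∃ a ∈ truncatedIntegers q D r, x = (a : K) * ((q : K) ^ r)⁻¹ := by
  have hq := ne_zero_coe h
  have key : ∀ (r : ℕ) (b : ℕ → 𝓞 K), ∑ j ∈ Finset.Icc 1 r, (b j : K) * ((q : K) ^ j)⁻¹ =
      ((∑ j ∈ Finset.range r, b (r - j) * q ^ j : 𝓞 K) : K) * ((q : K) ^ r)⁻¹ := by
    intro r b
    simp only [map_sum, Finset.sum_mul]
    refine Finset.sum_nbij' (fun j => r - j) (fun j => r - j) ?_ ?_ ?_ ?_ ?_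
    · intro j hj
      simp only [Finset.mem_Icc, Finset.mem_range] at hj ⊢
      omega
    · intro j hj
      simp only [Finset.mem_Icc, Finset.mem_range] at hj ⊢
      omega
    · intro j hj
      simp only [Finset.mem_Icc] at hj
      omega
    · intro j hj
      simp only [Finset.mem_range] at hj
      omega
    · intro j hj
      simp only [Finset.mem_Icc] at hj
      rw [show r - (r - j) = j by omega, map_mul, map_pow, mul_assoc]
      congr 1
      rw [eq_mul_inv_iff_mul_eq₀ (pow_ne_zero _ hq), ← div_eq_inv_mul,
        pow_sub₀ _ hq hj.2, div_eq_mul_inv]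
  constructor
  · rintro ⟨r, hr, b, hb, rfl⟩
    exact ⟨r, hr, _, ⟨fun j => b (r - j), fun j => hb _, rfl⟩, key r b⟩
  · rintro ⟨r, hr, _, ⟨b, hb, rfl⟩, rfl⟩
    refine ⟨r, hr, fun j => b (r - j), fun j => hb _, ?_⟩
    rw [key]
    congr 2
    refine Finset.sum_congr rfl fun j hj => ?_
    have := Finset.mem_range.1 hj
    rw [Nat.sub_sub_self this.le]

/-- The boundary of the tile is covered by the small tiles of level `n` whose address is a
boundary integer. -/
theorem exists_cover_frontier_realTile {q : 𝓞 K} {D : Finset (𝓞 K)} (h : IsNumberSystem q D)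
    (hf : HasFiniteness q D) (ω : Module.Basis (Fin d) ℤ (𝓞 K)) {r : ℝ} (hr : 1 < r)
    (hrφ : ∀ φ : K →+* ℂ, r ≤ ‖φ (q : K)‖) :
    ∃ R c : ℝ, 0 < c ∧ ∀ n : ℕ, ∀ x ∈ frontier (realTile ω q D),
      ∃ a ∈ boundaryIntegers q D R n,
        dist x (coordinates ω ((a : K) * ((q : K) ^ n)⁻¹)) ≤ c * (r ^ n)⁻¹ := by
  obtain ⟨c₀, hc₀, hN⟩ := exists_norm_le_of_mem_truncatedIntegers h
  obtain ⟨c₁, hc₁, hcx⟩ := exists_norm_coordinates_le ω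
  obtain ⟨c₂, hc₂, hcφ⟩ := exists_norm_embedding_le ω
  obtain ⟨M, hM1, hM⟩ := exists_norm_le q
  have hq := ne_zero_coe h
  have hN' : ∀ (φ : K →+* ℂ) (k : ℕ), ∀ t ∈ truncatedIntegers q D k,
      ‖φ ((t : K) * ((q : K) ^ k)⁻¹)‖ ≤ c₀ := by
    intro φ k t ht
    rw [map_mul, norm_mul, map_inv₀, map_pow, norm_inv, norm_pow, ← div_eq_mul_inv,
      div_le_iff₀ (pow_pos (one_pos.trans (h.one_lt_norm_conj φ)) _)]
    exact hN φ k t ht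
  refine ⟨1 + c₀ + c₀, 1 + c₁ * c₀, by positivity, fun n x hx => ?_⟩
  have hrn : 0 < (r ^ n)⁻¹ := inv_pos.2 (pow_pos (one_pos.trans hr) n)
  -- The first bound keeps `z` within `r ^ (-n)` of `x`; the second makes `(y - z) * q ^ n` at most
  -- `1` in every embedding.
  set δ : ℝ := min (r ^ n)⁻¹ (1 / (2 * c₂ * M ^ n)) with hδ
  have hδ0 : 0 < δ := lt_min hrn (by positivity)
  rw [frontier_eq_closure_inter_closure] at hx
  obtain ⟨hx1, hx2⟩ := hx
  rw [realTile, closure_closure] at hx1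
  obtain ⟨_, ⟨z, hz, rfl⟩, hxz⟩ := Metric.mem_closure_iff.1 hx1 δ hδ0
  obtain ⟨r', -, b, hb, hzb⟩ := (mem_fundamentalTile_iff h).1 hz
  obtain ⟨x', hx', hxx'⟩ := Metric.mem_closure_iff.1 hx2 (δ / 2) (half_pos hδ0)
  have hopen : IsOpen (realTile ω q D)ᶜ := isClosed_closure.isOpen_compl
  obtain ⟨ε, hε, hball⟩ := Metric.isOpen_iff.1 hopen x' hx'
  -- `y = a' / q ^ N` is a point off the tile close to `x`. The bound `N ≥ n + 1` allows a cut at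
  -- level `n` and keeps `N ≥ 1` when `n = 0`.
  obtain ⟨a', N, hNn, hdist⟩ := exists_dist_coordinates_lt h ω x'
    (lt_min hε (half_pos hδ0)) (n + 1)
  set y : K := (a' : K) * ((q : K) ^ N)⁻¹ with hy
  have hyF : coordinates ω y ∉ realTile ω q D :=
    hball (Metric.mem_ball'.2 (hdist.trans_le (min_le_left _ _)))
  have hxy : dist x (coordinates ω y) < δ := by
    have := hdist.trans_le (min_le_right _ _)
    linarith [dist_triangle x x' (coordinates ω y)]
  obtain ⟨k, rfl⟩ := Nat.exists_eq_add_of_le ((Nat.le_succ n).trans hNn)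
  obtain ⟨t, ht, hat⟩ := hf.exists_eq_add_digitTail k a'
  set a'' := digitTail q D k a'
  have ha'' : a'' ∉ truncatedIntegers q D n := by
    intro hc
    refine hyF (subset_closure ⟨y, (mem_fundamentalTile_iff h).2 ⟨n + k, by omega, a', ?_, hy⟩, rfl⟩)
    rw [hat, add_comm n k]
    exact add_mem_truncatedIntegers ht hc
  -- Padding with `n` zero digits gives `z` a level-`n` address whether or not `r' ≥ n`.
  have hpad : 0 + q ^ n * b ∈ truncatedIntegers q D (r' + n) := by
    rw [add_comm r' n]
    exact add_mem_truncatedIntegers (zero_mem_truncatedIntegers q h.zero_mem n) hb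
  obtain ⟨u, hu, a, ha, hua⟩ := exists_split_of_mem_truncatedIntegers hpad
  rw [zero_add] at hua
  have hyq : y * (q : K) ^ n = a'' + (t : K) * ((q : K) ^ k)⁻¹ := by
    rw [hy, hat]
    simp only [map_add, map_mul, map_pow, pow_add]
    field_simp
    ring
  have hzq : z * (q : K) ^ n = a + (u : K) * ((q : K) ^ r')⁻¹ := by
    have := congrArg (fun x : 𝓞 K => (x : K)) hua
    simp only [map_add, map_mul, map_pow] at this
    rw [hzb, mul_right_comm, mul_comm (b : K), this]
    field_simp
    ring
  refine ⟨a, ⟨a'' - a, fun φ => ?_, ha, by rwa [add_sub_cancel]⟩, ?_⟩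
  · have e : ((a'' - a : 𝓞 K) : K) =
        (y - z) * (q : K) ^ n - (t : K) * ((q : K) ^ k)⁻¹ + (u : K) * ((q : K) ^ r')⁻¹ := by
      rw [sub_mul, hyq, hzq]; simp only [map_sub]; ring
    have h1 : ‖φ ((y - z) * (q : K) ^ n)‖ ≤ 1 := by
      have h2 : ‖φ (y - z)‖ ≤ c₂ * (2 * δ) := by
        refine (hcφ _ φ).trans (mul_le_mul_of_nonneg_left ?_ hc₂.le)
        rw [coordinates_sub, ← dist_eq_norm]
        linarith [dist_triangle_left (coordinates ω y) (coordinates ω z) x]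
      have h3 : δ * (2 * c₂ * M ^ n) ≤ 1 :=
        (le_div_iff₀ (by positivity)).1 (min_le_right _ _)
      rw [map_mul, norm_mul, map_pow, norm_pow]
      calc _ ≤ c₂ * (2 * δ) * M ^ n := by
            gcongr
            exact hM φ
        _ = δ * (2 * c₂ * M ^ n) := by ring
        _ ≤ 1 := h3
    rw [e, map_add, map_sub]
    exact (norm_add_le _ _).trans (add_le_add ((norm_sub_le _ _).trans
      (add_le_add h1 (hN' φ k t ht))) (hN' φ r' u hu))
  · have h1 : ‖coordinates ω (z - (a : K) * ((q : K) ^ n)⁻¹)‖ ≤ c₁ * (c₀ * (r ^ n)⁻¹) := by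
      refine hcx _ _ fun φ => ?_
      have e : z - (a : K) * ((q : K) ^ n)⁻¹ =
          (u : K) * ((q : K) ^ r')⁻¹ * ((q : K) ^ n)⁻¹ := by
        rw [eq_mul_inv_iff_mul_eq₀ (pow_ne_zero _ hq), sub_mul, hzq, mul_assoc,
          inv_mul_cancel₀ (pow_ne_zero _ hq)]
        ring
      rw [e, map_mul, norm_mul, map_inv₀, map_pow, norm_inv, norm_pow]
      have : 0 < r := by linarith
      gcongr
      exacts [hN' φ r' u hu, hrφ φ]
    rw [coordinates_sub, ← dist_eq_norm] at h1
    have h2 := hxz.le.trans (min_le_left _ _)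
    calc _ ≤ _ := dist_triangle x (coordinates ω z) _
      _ ≤ (r ^ n)⁻¹ + c₁ * (c₀ * (r ^ n)⁻¹) := add_le_add h2 h1
      _ = _ := by ring

theorem upperBoxDim_frontier_realTile_le {q : 𝓞 K} {D : Finset (𝓞 K)} (h : IsNumberSystem q D)
    (hf : HasFiniteness q D) (ω : Module.Basis (Fin d) ℤ (𝓞 K)) {r B : ℝ} (hr : 1 < r)
    (hrφ : ∀ φ : K →+* ℂ, r ≤ ‖φ (q : K)‖) (hB : 1 ≤ B)
    (hov : ∀ s : 𝓞 K, ∃ A : ℝ, 0 ≤ A ∧ ∀ k, ((overflow q D k s).ncard : ℝ) ≤ A * B ^ k) :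
    upperBoxDim (frontier (realTile ω q D)) ≤ ((Real.log B / Real.log r : ℝ) : EReal) := by
  classical
  obtain ⟨R, c, hc, hcov⟩ := exists_cover_frontier_realTile h hf ω hr hrφ
  obtain ⟨A, hA1, hA⟩ := exists_ncard_boundaryIntegers_le h.zero_mem (by linarith : 0 ≤ B)
    (R := R) fun s _ => hov s
  refine upperBoxDim_le_of_cover hr hB hc hA1 fun n => ?_
  have hfin := boundaryIntegers_finite q h.zero_mem R n
  refine ⟨hfin.toFinset.image fun a : 𝓞 K => coordinates ω ((a : K) * ((q : K) ^ n)⁻¹), ?_,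
    fun x hx => ?_⟩
  · refine le_trans ?_ (hA n)
    rw [Set.ncard_eq_toFinset_card _ hfin]
    exact_mod_cast Finset.card_image_le
  · obtain ⟨a, ha, hxa⟩ := hcov n x hx
    exact ⟨_, Finset.mem_image_of_mem _ (hfin.mem_toFinset.2 ha), hxa⟩

/-- For the translates `q = q₀ - m`, the boundary of the tile has upper box dimension at most
`d - 1 + C / log m`. -/
theorem exists_upperBoxDim_translate_le (q₀ : 𝓞 K) :
    ∃ C : ℝ, ∀ m : ℕ, 2 ≤ m → ∀ q : 𝓞 K, q = -(m : 𝓞 K) + q₀ →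
      IsCNSBase q → HasFiniteness q (canonicalDigits q) →
        ∀ ω : Module.Basis (Fin (Module.finrank ℚ K)) ℤ (𝓞 K),
          upperBoxDim (frontier (realTile ω q (canonicalDigits q))) ≤
            (((Module.finrank ℚ K : ℝ) - 1 + C / Real.log m : ℝ) : EReal) := by
  obtain ⟨B, hB1, hB⟩ := exists_ncard_overflow_translate_le q₀
  obtain ⟨H, hH1, hH⟩ := exists_norm_le q₀
  have hd1 : 0 < Module.finrank ℚ K := Module.finrank_pos
  obtain ⟨e, hd⟩ : ∃ e, Module.finrank ℚ K = e + 1 := ⟨_, (Nat.succ_pred_eq_of_pos hd1).symm⟩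
  have hlB : 0 ≤ Real.log B := Real.log_nonneg hB1
  have hl2 : 0 < Real.log 2 := Real.log_pos one_lt_two
  have hBm : ∀ m : ℕ, 2 ≤ m → 1 ≤ B * (m : ℝ) ^ (Module.finrank ℚ K - 1) := fun m hm =>
    one_le_mul_of_one_le_of_one_le hB1 (one_le_pow₀ (by exact_mod_cast (by omega : 1 ≤ m)))
  -- For fixed `m` the base is determined, and its own `r > 1` gives some finite bound. This serves
  -- the `m` below `M`, where `m / 2` need not bound the conjugates from below.
  have hsmall : ∀ m : ℕ, ∃ c : ℝ, 0 ≤ c ∧ (2 ≤ m → ∀ q : 𝓞 K, q = -(m : 𝓞 K) + q₀ →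
      IsCNSBase q → HasFiniteness q (canonicalDigits q) →
        ∀ ω : Module.Basis (Fin (Module.finrank ℚ K)) ℤ (𝓞 K),
          upperBoxDim (frontier (realTile ω q (canonicalDigits q))) ≤ (c : EReal)) := by
    intro m
    by_cases hm : 2 ≤ m ∧ IsCNSBase (-(m : 𝓞 K) + q₀)
    · obtain ⟨r, hr, hrφ⟩ := exists_one_lt_le_norm hm.2
      refine ⟨Real.log (B * (m : ℝ) ^ (Module.finrank ℚ K - 1)) / Real.log r,
        div_nonneg (Real.log_nonneg (hBm m hm.1)) (Real.log_nonneg hr.le), fun h2 q hq hb hf ω => ?_⟩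
      subst hq
      exact upperBoxDim_frontier_realTile_le hb hf ω hr hrφ (hBm m h2)
        (hB m (by omega) _ rfl hb hf)
    · exact ⟨0, le_rfl, fun h2 q hq hb => absurd ⟨h2, hq ▸ hb⟩ hm⟩
  choose c hc0 hc using hsmall
  set M := ⌈max 4 (2 * H)⌉₊ with hM
  -- The first summand handles large `m`, with the `2` from `log (m / 2) ≥ log m / 2`; the sum
  -- ensures `c m ≤ C / log m` when `2 ≤ m < M`.
  set C := 2 * (e * Real.log 2 + Real.log B) + ∑ m ∈ Finset.range M, c m * |Real.log m| with hC
  have hsum : 0 ≤ ∑ m ∈ Finset.range M, c m * |Real.log m| :=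
    Finset.sum_nonneg fun m _ => mul_nonneg (hc0 m) (abs_nonneg _)
  have he0 : (0 : ℝ) ≤ e := Nat.cast_nonneg _
  refine ⟨C, fun m hm q hq hb hf ω => ?_⟩
  have hm0 : (0 : ℝ) < m := by exact_mod_cast (by omega : 0 < m)
  have hL : 0 < Real.log m := Real.log_pos (by exact_mod_cast (by omega : 1 < m))
  have hde : (Module.finrank ℚ K : ℝ) - 1 = e := by rw [hd]; push_cast; ring
  rw [hde]
  rcases lt_or_ge m M with hmM | hmM
  · refine (hc m hm q hq hb hf ω).trans (EReal.coe_le_coe_iff.2 ?_)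
    have h1 : c m * Real.log m ≤ C := by
      have := Finset.single_le_sum (f := fun m : ℕ => c m * |Real.log m|)
        (fun m _ => mul_nonneg (hc0 m) (abs_nonneg _)) (Finset.mem_range.2 hmM)
      simp only [abs_of_pos hL] at this
      have : 0 ≤ e * Real.log 2 := by positivity
      linarith
    have h2 : c m ≤ C / Real.log m := (le_div_iff₀ hL).2 h1
    linarith
  · have hmM' : max 4 (2 * H) ≤ (m : ℝ) := Nat.ceil_le.1 hmM
    have hm4 : 4 ≤ m := by exact_mod_cast (le_max_left _ _).trans hmM'
    have hm4' : (4 : ℝ) ≤ m := by exact_mod_cast hm4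
    have hrφ : ∀ φ : K →+* ℂ, (m : ℝ) / 2 ≤ ‖φ (q : K)‖ := fun φ =>
      hq ▸ half_le_norm_translate hH ((le_max_right _ _).trans hmM') φ
    refine (upperBoxDim_frontier_realTile_le hb hf ω (by linarith) hrφ (hBm m hm)
      (hB m (by omega) q hq hb hf)).trans (EReal.coe_le_coe_iff.2 ?_)
    have hhalf := half_log_le_log_half hm4
    have hl : 0 < Real.log ((m : ℝ) / 2) := by linarith
    rw [hd, Nat.add_sub_cancel, Real.log_mul (by positivity) (by positivity), Real.log_pow,
      div_le_iff₀ hl]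
    have h1 : 1 / 2 ≤ Real.log ((m : ℝ) / 2) / Real.log m := by
      rw [le_div_iff₀ hL]; linarith
    have h2 : e * Real.log 2 + Real.log B ≤ C * (Real.log ((m : ℝ) / 2) / Real.log m) := by
      calc _ ≤ C * (1 / 2) := by rw [hC]; linarith
        _ ≤ _ := mul_le_mul_of_nonneg_left h1 (by positivity)
    have h3 : Real.log ((m : ℝ) / 2) = Real.log m - Real.log 2 :=
      Real.log_div hm0.ne' two_ne_zero
    have h4 : (e + C / Real.log m) * Real.log ((m : ℝ) / 2) =
        e * Real.log ((m : ℝ) / 2) + C * (Real.log ((m : ℝ) / 2) / Real.log m) := by ring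
    rw [h4]
    have h5 : e * Real.log ((m : ℝ) / 2) = e * Real.log m - e * Real.log 2 := by rw [h3]; ring
    linarith

end NumerationSystem

open NumerationSystem in
theorem propositionA1 (K : Type*) [Field K] [NumberField K] (q₀ : 𝓞 K) (hq₀ : IsCNSBase q₀) :
    ∃ C : ℝ, ∀ m : ℕ, 2 ≤ m → ∀ q : 𝓞 K, q = -(m : 𝓞 K) + q₀ →
      IsCNSBase q → HasFiniteness q (canonicalDigits q) →
        (∃ η : ℝ, IsCarryConstant q (canonicalDigits q) η ∧
          1 / (Module.finrank ℚ K : ℝ) - C / Real.log m ≤ η) ∧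
        ∀ ω : Module.Basis (Fin (Module.finrank ℚ K)) ℤ (𝓞 K),
          upperBoxDim (frontier (realTile ω q (canonicalDigits q))) ≤
            (((Module.finrank ℚ K : ℝ) - 1 + C / Real.log m : ℝ) : EReal) := by
  obtain ⟨C₁, h₁⟩ := exists_isCarryConstant_translate q₀
  obtain ⟨C₂, h₂⟩ := exists_upperBoxDim_translate_le q₀
  refine ⟨max C₁ C₂, fun m hm q hq hb hf => ?_⟩
  have hL : 0 < Real.log m := Real.log_pos (by exact_mod_cast (by omega : 1 < m))
  constructor
  · obtain ⟨η, hη, hle⟩ := h₁ m hm q hq hb hf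
    refine ⟨η, hη, le_trans ?_ hle⟩
    have : C₁ / Real.log m ≤ max C₁ C₂ / Real.log m := by gcongr; exact le_max_left _ _
    linarith
  · intro ω
    refine (h₂ m hm q hq hb hf ω).trans (EReal.coe_le_coe_iff.2 ?_)
    gcongr
    exact le_max_right _ _
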